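/- Let $\Sigma$ be a rational pointed fan in $\mathbb R^d$, i.e. a finite collection of rational pointed (strongly convex polyhedral) cones such that, for $C'\subseteq C$ with $C\in\Sigma$, $C'$ is a face of $C$ if and only if $C'\in\Sigma$, and such that $C\cap C'$ is a common face of $C$ and $C'$ for all $C,C'\in\Sigma$. Let $K$ be a field. The toric face ring $K[\Sigma]$ is the $K$-vector space with basis the monomials $x^a$, $a\in\bigcup_{C\in\Sigma}C\cap\mathbb Z^d$, with multiplication $x^a\cdot x^b=x^{a+b}$ if $a,b$ lie in a common cone of $\Sigma$ and $x^a\cdot x^b=0$ otherwise. A ring $R$ is called clean if it has a finite filtration $0=M_0\subset M_1\subset\dots\subset M_r=R$ by ideals with $M_i/M_{i-1}\cong R/P_i$ as $R$-modules for prime ideals $P_i$ such that $\{P_1,\dots,P_r\}=\operatorname{Min}(\operatorname{Supp} R)$, the set of minimal primes of $R$. For a cone $C$ let $\operatorname{fan}(C)$ be the set of faces of $C$ and $\operatorname{fan}(\partial C)$ the set of proper faces of $C$. For a fan $\Sigma$ and $a\in\mathbb Z^d$ let $\operatorname{star}_\Sigma(a)=\{D\in\Sigma: a\in D\}$. A (non-pure)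 shelling of a fan $\Sigma$ is a linear ordering $C_1,\dots,C_s$ of the facets (maximal cones) of $\Sigma$ such that either $\dim\Sigma=0$, or $\operatorname{fan}(\partial C_1)$ has a shelling and for every $1<j\le s$ there is a shelling $D_1,\dots,D_{t_j}$ of $\operatorname{fan}(\partial C_j)$ with $$\emptyset\ne\bigcup_{i=1}^{j-1}\operatorname{fan}(C_i)\cap\operatorname{fan}(C_j)=\bigcup_{l=1}^{r_j}\operatorname{fan}(D_l)\quad\text{for some }1\le r_j\le t_j.$$ Then $K[\Sigma]$ is clean if and only if the following conditions are satisfied: (i) $\Sigma$ is shellable with some shelling $C_1,\dots,C_s$; (ii) for this shelling and every $1<j\le s$ there exists $\gamma_j\in C_j\cap\mathbb Z^d$ such that (a) $\operatorname{star}_{\operatorname{fan}(C_j)}(\gamma_j)=\operatorname{fan}(C_j)\setminus\bigcup_{i=1}^{j-1}\operatorname{fan}(C_i)$, and (b) $\bigcup_{D\in\operatorname{star}_{\operatorname{fan}(C_j)}(\gamma_j)}\operatorname{relint}(D)\cap\mathbb Z^d=\gamma_j+(C_j\cap\mathbb Z^d)$. In particular, cleanness does not depend on $K$ (hence not on $\operatorname{char}K$):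 for any two fields $K$ and $L$, $K[\Sigma]$ is clean if and only if $L[\Sigma]$ is clean. -/

import Mathlib

/-- The inclusion `ℤ^d ⊆ ℝ^d`. -/
def latticeVec {d : ℕ} (a : Fin d → ℤ) : Fin d → ℝ := fun i => (a i : ℝ)

/-- Convex cones in `ℝ^d` with apex `0`. -/
abbrev RCone (d : ℕ) := PointedCone ℝ (Fin d → ℝ)

namespace RCone

variable {d : ℕ}

/-- A cone is rational if it is generated by finitely many lattice vectors. -/
def IsRational (C : RCone d) : Prop :=
  ∃ s : Finset (Fin d → ℤ), C = PointedCone.hull ℝ (latticeVec '' (s : Set (Fin d → ℤ)))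

/-- A cone is pointed (strongly convex) if it contains no line. In Mathlib this is called
`Salient`; there, "pointed" just means that the cone contains `0`. -/
def IsStronglyConvex (C : RCone d) : Prop := (C : ConvexCone ℝ (Fin d → ℝ)).Salient

/-- The set `C ∩ ℤ^d`. -/
def latticePoints (C : RCone d) : Set (Fin d → ℤ) := {a | latticeVec a ∈ C}

/-- The set `relint(C) ∩ ℤ^d`. -/
def relintLatticePoints (C : RCone d) : Set (Fin d → ℤ) :=
  {a | latticeVec a ∈ intrinsicInterior ℝ (C : Set (Fin d → ℝ))}

/-- `fan(C)`, the set of faces of `C`. -/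
def fan (C : RCone d) : Set (RCone d) := {D | D.IsFaceOf C}

/-- `fan(∂C)`, the set of faces of the boundary of `C`, i.e. of proper faces of `C`. -/
def boundaryFan (C : RCone d) : Set (RCone d) := {D | D.IsFaceOf C ∧ D ≠ C}

/-- The dimension of a cone. -/
noncomputable def dim (C : RCone d) : ℕ :=
  Module.finrank ℝ (Submodule.span ℝ (C : Set (Fin d → ℝ)))

end RCone

/-- The dimension of a collection of cones in `ℝ^d`, the maximal dimension of a member. -/
noncomputable def fanDim {d : ℕ} (S : Set (RCone d)) : ℕ := sSup (RCone.dim '' S)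

/-- The star of a lattice point in a collection of cones. -/
def latticeStar {d : ℕ} (S : Set (RCone d)) (a : Fin d → ℤ) : Set (RCone d) :=
  {D | D ∈ S ∧ latticeVec a ∈ D}

/-- `C_1, …, C_s` is a linear ordering (without repetition) of the facets, i.e. of the maximal
members, of `S`. -/
def IsFacetOrdering {d : ℕ} (S : Set (RCone d)) {s : ℕ} (C : Fin s → RCone d) : Prop :=
  Function.Injective C ∧ ∀ D, D ∈ Set.range C ↔ Maximal (· ∈ S) D

/-- (Non-pure) shellings. In `step`, the list `D j` is a shelling of `fan(∂C_j)`, and for every `j`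
other than the first, an initial segment of it describes
`⋃_{i < j} fan(C_i) ∩ fan(C_j)`. -/
inductive IsShelling {d : ℕ} : Set (RCone d) → {s : ℕ} → (Fin s → RCone d) → Prop
  | dim_zero {S : Set (RCone d)} {s : ℕ} {C : Fin s → RCone d}
      (facets : IsFacetOrdering S C) (dim_eq : fanDim S = 0) : IsShelling S C
  | step {S : Set (RCone d)} {s : ℕ} {C : Fin s → RCone d}
      (facets : IsFacetOrdering S C)
      (t : Fin s → ℕ) (D : (j : Fin s) → Fin (t j) → RCone d)
      (shelling : ∀ j, IsShelling (RCone.boundaryFan (C j)) (D j))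
      (inter : ∀ j : Fin s, 0 < (j : ℕ) →
        (⋃ i : Fin s, ⋃ _ : i < j, (C i).fan ∩ (C j).fan).Nonempty ∧
        ∃ r : ℕ, 1 ≤ r ∧ r ≤ t j ∧
          (⋃ i : Fin s, ⋃ _ : i < j, (C i).fan ∩ (C j).fan) =
            ⋃ l : Fin (t j), ⋃ _ : (l : ℕ) < r, (D j l).fan) : IsShelling S C

/-- A rational pointed fan in `ℝ^d`. -/
structure RationalPointedFan (d : ℕ) where
  /-- The cones of the fan. -/
  cones : Set (RCone d)
  finite : cones.Finite
  rational : ∀ C ∈ cones, C.IsRational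
  pointed : ∀ C ∈ cones, C.IsStronglyConvex
  face_iff : ∀ C ∈ cones, ∀ C' ≤ C, PointedCone.IsFaceOf C' C ↔ C' ∈ cones
  inter_face : ∀ C ∈ cones, ∀ C' ∈ cones,
    PointedCone.IsFaceOf (C ⊓ C') C ∧ PointedCone.IsFaceOf (C ⊓ C') C'

namespace RationalPointedFan

variable {d : ℕ}

/-- The lattice points in the support of a fan, the set `⋃_{C} C ∩ ℤ^d`. -/
def latticePoints (S : RationalPointedFan d) : Set (Fin d → ℤ) :=
  {a | ∃ C ∈ S.cones, a ∈ C.latticePoints}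

/-- `a` and `b` lie in a common cone of the fan. -/
def InCommonCone (S : RationalPointedFan d) (a b : Fin d → ℤ) : Prop :=
  ∃ C ∈ S.cones, a ∈ C.latticePoints ∧ b ∈ C.latticePoints

theorem latticeVec_add (a b : Fin d → ℤ) :
    latticeVec (a + b) = latticeVec a + latticeVec b := by
  funext i; simp [latticeVec]

theorem latticeVec_zero : latticeVec (0 : Fin d → ℤ) = 0 := by
  funext i; simp [latticeVec]

theorem InCommonCone.add_mem {S : RationalPointedFan d} {a b : Fin d → ℤ}
    (h : S.InCommonCone a b) : a + b ∈ S.latticePoints := by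
  obtain ⟨C, hC, ha, hb⟩ := h
  refine ⟨C, hC, ?_⟩
  change latticeVec (a + b) ∈ C
  rw [latticeVec_add]
  exact Submodule.add_mem C ha hb

theorem inCommonCone_comm {S : RationalPointedFan d} {a b : Fin d → ℤ} :
    S.InCommonCone a b ↔ S.InCommonCone b a :=
  ⟨fun ⟨C, hC, ha, hb⟩ => ⟨C, hC, hb, ha⟩, fun ⟨C, hC, ha, hb⟩ => ⟨C, hC, hb, ha⟩⟩

/-- A triple of lattice points in a common cone, described in steps. -/
theorem inCommonCone_add_iff {S : RationalPointedFan d} {a b c : Fin d → ℤ} :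
    (S.InCommonCone a b ∧ S.InCommonCone (a + b) c) ↔
      ∃ C ∈ S.cones, a ∈ C.latticePoints ∧ b ∈ C.latticePoints ∧ c ∈ C.latticePoints := by
  constructor
  · rintro ⟨⟨C, hC, ha, hb⟩, ⟨C', hC', hab, hc⟩⟩
    change latticeVec (a + b) ∈ C' at hab
    rw [latticeVec_add] at hab
    have hF := (S.inter_face C hC C' hC').1
    have hmem : latticeVec a + latticeVec b ∈ C ⊓ C' :=
      ⟨Submodule.add_mem C ha hb, hab⟩
    exact ⟨C', hC', (hF.mem_of_add_mem_left ha hb hmem).2,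
      (hF.mem_of_add_mem_right ha hb hmem).2, hc⟩
  · rintro ⟨C, hC, ha, hb, hc⟩
    refine ⟨⟨C, hC, ha, hb⟩, ⟨C, hC, ?_, hc⟩⟩
    change latticeVec (a + b) ∈ C
    rw [latticeVec_add]
    exact Submodule.add_mem C ha hb

end RationalPointedFan

/-- The toric face ring `K[Σ]`: the `K`-vector space with basis the monomials `x^a` for the
lattice points `a` of the fan. -/
def ToricFaceRing {d : ℕ} (K : Type*) [Field K] (S : RationalPointedFan d) : Type _ :=
  S.latticePoints →₀ K

namespace ToricFaceRing

variable {d : ℕ} {K : Type*} [Field K] {S : RationalPointedFan d}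

noncomputable instance : AddCommGroup (ToricFaceRing K S) :=
  inferInstanceAs (AddCommGroup (S.latticePoints →₀ K))

noncomputable instance : Module K (ToricFaceRing K S) :=
  inferInstanceAs (Module K (S.latticePoints →₀ K))

/-- The monomial `x^a`. -/
noncomputable def monomial (a : S.latticePoints) : ToricFaceRing K S :=
  (Finsupp.single a 1 : S.latticePoints →₀ K)

/-- The linear map that sends `x^a` to `v a`. -/
noncomputable def extend {M : Type*} [AddCommGroup M] [Module K M] (v : S.latticePoints → M) :
    ToricFaceRing K S →ₗ[K] M :=
  (Finsupp.linearCombination K v : (S.latticePoints →₀ K) →ₗ[K] M)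

theorem extend_monomial {M : Type*} [AddCommGroup M] [Module K M] (v : S.latticePoints → M)
    (a : S.latticePoints) : extend (K := K) v (monomial a) = v a :=
  (Finsupp.linearCombination_single K 1 a).trans (one_smul K (v a))

theorem hom_ext {M : Type*} [AddCommGroup M] [Module K M] {f g : ToricFaceRing K S →ₗ[K] M}
    (h : ∀ a, f (monomial a) = g (monomial a)) : f = g := by
  apply Finsupp.lhom_ext'
  intro a
  apply LinearMap.ext_ring
  exact h a

open Classical in
/-- The product of two monomials: `x^(a+b)` if `a`, `b` lie in a common cone and `0` otherwise. -/
noncomputable def monomialMul (a b : S.latticePoints) : ToricFaceRing K S :=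
  if h : S.InCommonCone a b then monomial ⟨a.1 + b.1, h.add_mem⟩ else 0

/-- The bilinear extension of the multiplication of monomials. -/
noncomputable def mulLin : ToricFaceRing K S →ₗ[K] ToricFaceRing K S →ₗ[K] ToricFaceRing K S :=
  extend fun a => extend (monomialMul a)

noncomputable instance : Mul (ToricFaceRing K S) := ⟨fun f g => mulLin f g⟩

open Classical in
/-- The unit is `x^0` (and is `0` in the zero ring of the empty fan). -/
noncomputable instance : One (ToricFaceRing K S) :=
  ⟨if h : (0 : Fin d → ℤ) ∈ S.latticePoints then monomial ⟨0, h⟩ else 0⟩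

theorem mul_def (f g : ToricFaceRing K S) : f * g = mulLin f g := rfl

open Classical in
theorem monomial_mul_monomial (a b : S.latticePoints) :
    (monomial a * monomial b : ToricFaceRing K S) =
      if h : S.InCommonCone a b then monomial ⟨a.1 + b.1, h.add_mem⟩ else 0 := by
  simp only [mul_def, mulLin, extend_monomial, monomialMul]

theorem monomial_mul_comm (a b : S.latticePoints) :
    (monomial a * monomial b : ToricFaceRing K S) = monomial b * monomial a := by
  rw [monomial_mul_monomial, monomial_mul_monomial]
  by_cases h : S.InCommonCone a b
  · rw [dif_pos h, dif_pos (RationalPointedFan.inCommonCone_comm.1 h)]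
    congr 1
    exact Subtype.ext (add_comm _ _)
  · rw [dif_neg h, dif_neg (fun h' => h (RationalPointedFan.inCommonCone_comm.1 h'))]

theorem mul_comm' (f g : ToricFaceRing K S) : f * g = g * f := by
  have h : (mulLin : ToricFaceRing K S →ₗ[K] _) = mulLin.flip := by
    refine hom_ext fun a => hom_ext fun b => ?_
    exact monomial_mul_comm a b
  exact LinearMap.congr_fun (LinearMap.congr_fun h f) g

open Classical in
theorem monomial_mul_mul (a b c : S.latticePoints) :
    (monomial a * monomial b * monomial c : ToricFaceRing K S) =
      if h : ∃ C ∈ S.cones, (a : Fin d → ℤ) ∈ C.latticePoints ∧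
          (b : Fin d → ℤ) ∈ C.latticePoints ∧ (c : Fin d → ℤ) ∈ C.latticePoints then
        monomial ⟨a.1 + b.1 + c.1, (RationalPointedFan.inCommonCone_add_iff.2 h).2.add_mem⟩
      else 0 := by
  rw [monomial_mul_monomial]
  by_cases h1 : S.InCommonCone a b
  · rw [dif_pos h1, monomial_mul_monomial]
    by_cases h2 : S.InCommonCone (a + b) c
    · rw [dif_pos h2, dif_pos (RationalPointedFan.inCommonCone_add_iff.1 ⟨h1, h2⟩)]
    · rw [dif_neg h2, dif_neg fun h => h2 (RationalPointedFan.inCommonCone_add_iff.2 h).2]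
  · rw [dif_neg h1, dif_neg fun h => h1 (RationalPointedFan.inCommonCone_add_iff.2 h).1]
    simp [mul_def]

theorem monomial_mul_assoc (a b c : S.latticePoints) :
    (monomial a * monomial b * monomial c : ToricFaceRing K S) =
      monomial a * (monomial b * monomial c) := by
  rw [mul_comm' (monomial a) (monomial b * monomial c), monomial_mul_mul, monomial_mul_mul]
  by_cases h : ∃ C ∈ S.cones, (a : Fin d → ℤ) ∈ C.latticePoints ∧
          (b : Fin d → ℤ) ∈ C.latticePoints ∧ (c : Fin d → ℤ) ∈ C.latticePoints
  · have h' : ∃ C ∈ S.cones, (b : Fin d → ℤ) ∈ C.latticePoints ∧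
          (c : Fin d → ℤ) ∈ C.latticePoints ∧ (a : Fin d → ℤ) ∈ C.latticePoints := by
      obtain ⟨C, hC, ha, hb, hc⟩ := h
      exact ⟨C, hC, hb, hc, ha⟩
    rw [dif_pos h, dif_pos h']
    congr 1
    apply Subtype.ext
    change (a : Fin d → ℤ) + b + c = b + c + a
    abel
  · rw [dif_neg h, dif_neg]
    rintro ⟨C, hC, hb, hc, ha⟩
    exact h ⟨C, hC, ha, hb, hc⟩

theorem mul_assoc' (f g k : ToricFaceRing K S) : f * g * k = f * (g * k) := by
  have h1 (a b : S.latticePoints) : mulLin (monomial a * monomial b) =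
      (mulLin (monomial a)).comp (mulLin (K := K) (monomial b)) :=
    hom_ext fun c => monomial_mul_assoc a b c
  have h2 (a : S.latticePoints) : (mulLin.flip k).comp (mulLin (monomial a)) =
      (mulLin (monomial a)).comp (mulLin.flip k) :=
    hom_ext fun b => LinearMap.congr_fun (h1 a b) k
  have h3 : (mulLin.flip k).comp (mulLin.flip g) = mulLin.flip (g * k) :=
    hom_ext fun a => LinearMap.congr_fun (h2 a) g
  exact LinearMap.congr_fun h3 f

theorem one_mul' (f : ToricFaceRing K S) : 1 * f = f := by
  have h : (mulLin (1 : ToricFaceRing K S)) = LinearMap.id := by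
    refine hom_ext fun b => ?_
    obtain ⟨b, C, hC, hb⟩ := b
    have h0 : (0 : Fin d → ℤ) ∈ C.latticePoints := by
      change latticeVec 0 ∈ C
      rw [RationalPointedFan.latticeVec_zero]
      exact Submodule.zero_mem C
    have h1 : (1 : ToricFaceRing K S) = monomial ⟨0, C, hC, h0⟩ :=
      dif_pos (⟨C, hC, h0⟩ : (0 : Fin d → ℤ) ∈ S.latticePoints)
    rw [← mul_def, h1, monomial_mul_monomial, dif_pos ⟨C, hC, h0, hb⟩, LinearMap.id_apply]
    congr 1
    exact Subtype.ext (zero_add b)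
  exact LinearMap.congr_fun h f

noncomputable instance : CommRing (ToricFaceRing K S) where
  __ := (inferInstance : AddCommGroup (ToricFaceRing K S))
  left_distrib f g k := by simp [mul_def]
  right_distrib f g k := by simp [mul_def]
  zero_mul f := by simp [mul_def]
  mul_zero f := by simp [mul_def]
  mul_assoc := mul_assoc'
  one_mul := one_mul'
  mul_one f := by rw [mul_comm', one_mul']
  mul_comm := mul_comm'

end ToricFaceRing

/-- `M` has a clean filtration: a filtration `0 = M_0 ⊆ ⋯ ⊆ M_r = M` with
`M_i / M_{i-1} ≅ R / P_i` for primes `P_i` (so that the inclusions are strict), such that the set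
of the `P_i` is the set of minimal elements of `Supp M`. -/
def IsCleanModule (R M : Type*) [CommRing R] [AddCommGroup M] [Module R M] : Prop :=
  ∃ (r : ℕ) (N : Fin (r + 1) → Submodule R M) (P : Fin r → PrimeSpectrum R),
    N 0 = ⊥ ∧ N (Fin.last r) = ⊤ ∧
    (∀ i : Fin r, N i.castSucc ≤ N i.succ ∧
      Nonempty ((N i.succ ⧸ (N i.castSucc).submoduleOf (N i.succ)) ≃ₗ[R]
        (R ⧸ (P i).asIdeal))) ∧
    Set.range P = {p | Minimal (· ∈ Module.support R M) p}

/-- A ring is clean if it is clean as a module over itself. -/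
def IsCleanRing (R : Type*) [CommRing R] : Prop := IsCleanModule R R

/-! Both sides are equivalent to one statement that does not mention the field: the facets can be
ordered so that, for every `j`, the lattice points of `C j` outside all earlier facets (`newPoints`)
form a translate `γ + (C j ∩ ℤ^d)`. Independence of the field is then immediate.

On the algebraic side, the minimal primes of `K[Σ]` are the ideals `facePrime` of the facets. They
intersect in zero, and localizing at any of them gives a field. Hence in a clean filtration each
occurs once, and every step is the intersection of the primes still to come (`filtration_eq_iInf`).
The successive quotients therefore have as bases the monomials with new exponents, for the reversed
order of facets. Such a quotient is cyclic exactly when its exponents form a translate: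
`exists_translate_of_cyclic` gives one direction, and the monomial `x^γ` as generator the other.

On the geometric side, every lattice point lies in the relative interior of a face, which turns the
left side of (b) into the set of new points once (a) holds; conversely, (a) follows from the
translate property. Shellability also follows: the faces that `C j` shares with earlier facets are
those missing `γ`, and a Bruggesser–Mani line shelling of the boundary of `C j` can begin with
exactly the facets missing `γ` (`IsFacetSystem.exists_shelling`, `isShelling_of_newPoints_eq`). -/

open Filter Topology

/-! ### Polyhedral cones: halfspace descriptions, faces, facets -/

/-- The cone of all points of the subspace `V` at which all functionals in `I` are nonnegative. -/
def halfspaceCone {d : ℕ} (V : Submodule ℝ (Fin d → ℝ))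
    (I : Finset (Module.Dual ℝ (Fin d → ℝ))) : RCone d where
  carrier := {x | x ∈ V ∧ ∀ l ∈ I, 0 ≤ l x}
  add_mem' hx hy := ⟨V.add_mem hx.1 hy.1, fun l hl => by
    rw [map_add]; exact add_nonneg (hx.2 l hl) (hy.2 l hl)⟩
  zero_mem' := ⟨V.zero_mem, fun l _ => by simp⟩
  smul_mem' c x hx := ⟨V.smul_mem (c : ℝ) hx.1, fun l hl => by
    change 0 ≤ l ((c : ℝ) • x)
    rw [map_smul]; exact mul_nonneg c.2 (hx.2 l hl)⟩

section HalfspaceCone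

variable {d : ℕ} {V : Submodule ℝ (Fin d → ℝ)} {I : Finset (Module.Dual ℝ (Fin d → ℝ))}

theorem mem_halfspaceCone {x : Fin d → ℝ} :
    x ∈ halfspaceCone V I ↔ x ∈ V ∧ ∀ l ∈ I, 0 ≤ l x := Iff.rfl

theorem RCone.smul_mem {C : RCone d} {c : ℝ} {x : Fin d → ℝ} (hc : 0 ≤ c) (hx : x ∈ C) :
    c • x ∈ C := Submodule.smul_mem C (⟨c, hc⟩ : {c : ℝ // 0 ≤ c}) hx

/-- One step of Fourier–Motzkin elimination. -/
theorem exists_halfspaceCone_sup_ray (I : Finset (Module.Dual ℝ (Fin d → ℝ))) (v : Fin d → ℝ) :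
    ∃ J : Finset (Module.Dual ℝ (Fin d → ℝ)), ∀ x, x ∈ halfspaceCone ⊤ J ↔
      ∃ t : ℝ, 0 ≤ t ∧ x - t • v ∈ halfspaceCone ⊤ I := by
  classical
  -- A functional negative at `v` bounds `t` from below, one positive at `v` from above. The
  -- combination of such a pair that vanishes at `v` says that the two bounds are compatible.
  refine ⟨I.filter (fun l => 0 ≤ l v) ∪
    ((I ×ˢ I).filter (fun q => q.1 v < 0 ∧ 0 < q.2 v)).image
      (fun q => q.2 v • q.1 - q.1 v • q.2), fun x => ?_⟩
  simp only [mem_halfspaceCone, Submodule.mem_top, true_and, Finset.mem_union, Finset.mem_filter,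
    Finset.mem_image, Finset.mem_product, Prod.exists, map_sub, map_smul, smul_eq_mul]
  constructor
  · intro h
    have hfin : (insert (0 : ℝ) ((fun l : Module.Dual ℝ (Fin d → ℝ) => l x / l v) ''
        {l | l ∈ I ∧ l v < 0})).Finite :=
      ((I.finite_toSet.subset fun l hl => hl.1).image _).insert 0
    obtain ⟨t, ht, hmax⟩ := Set.exists_max_image _ id hfin ⟨0, Set.mem_insert _ _⟩
    refine ⟨t, hmax 0 (Set.mem_insert _ _), fun l hl => ?_⟩
    rcases lt_trichotomy (l v) 0 with hlv | hlv | hlv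
    · have := hmax _ (Set.mem_insert_of_mem _ ⟨l, ⟨hl, hlv⟩, rfl⟩)
      simp only [id] at this
      rw [div_le_iff_of_neg hlv] at this
      linarith
    · rw [hlv, mul_zero, sub_zero]
      exact h l (Or.inl ⟨hl, hlv.ge⟩)
    · rcases ht with rfl | ⟨m, ⟨hm, hmv⟩, rfl⟩
      · rw [zero_mul, sub_zero]
        exact h l (Or.inl ⟨hl, hlv.le⟩)
      · have := h _ (Or.inr ⟨m, l, ⟨⟨hm, hl⟩, hmv, hlv⟩, rfl⟩)
        simp only [LinearMap.sub_apply, LinearMap.smul_apply, smul_eq_mul] at this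
        have h2 : m x / m v * l v ≤ l x := by
          rw [div_mul_eq_mul_div, div_le_iff_of_neg hmv]
          linarith
        linarith
  · rintro ⟨t, ht, h⟩ l (⟨hl, hlv⟩ | ⟨m, k, ⟨⟨hm, hk⟩, hmv, hkv⟩, rfl⟩)
    · have := h l hl
      have := mul_nonneg ht hlv
      linarith
    · simp only [LinearMap.sub_apply, LinearMap.smul_apply, smul_eq_mul]
      have h1 := mul_nonneg hkv.le (h m hm)
      have h2 := mul_nonneg (neg_nonneg.2 hmv.le) (h k hk)
      linarith

/-- Finitely generated cones are finite intersections of halfspaces. -/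
theorem exists_halfspaceCone_eq_hull (s : Finset (Fin d → ℝ)) :
    ∃ J : Finset (Module.Dual ℝ (Fin d → ℝ)),
      PointedCone.hull ℝ (s : Set (Fin d → ℝ)) = halfspaceCone ⊤ J := by
  classical
  induction s using Finset.induction_on with
  | empty =>
    refine ⟨Finset.univ.image (fun i => (LinearMap.proj i : Module.Dual ℝ (Fin d → ℝ))) ∪
      Finset.univ.image (fun i => -(LinearMap.proj i : Module.Dual ℝ (Fin d → ℝ))), ?_⟩
    ext x
    simp only [Finset.coe_empty, PointedCone.hull, Submodule.span_empty, Submodule.mem_bot,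
      mem_halfspaceCone, Submodule.mem_top, true_and, Finset.mem_union, Finset.mem_image,
      Finset.mem_univ]
    constructor
    · rintro rfl l -
      simp
    · intro h
      funext i
      have h1 := h _ (Or.inl ⟨i, rfl⟩)
      have h2 := h _ (Or.inr ⟨i, rfl⟩)
      simp only [LinearMap.proj_apply, LinearMap.neg_apply] at h1 h2
      exact le_antisymm (neg_nonneg.1 h2) h1
  | insert v s _ ih =>
    obtain ⟨I, hI⟩ := ih
    obtain ⟨J, hJ⟩ := exists_halfspaceCone_sup_ray I v
    refine ⟨J, ?_⟩
    ext x
    rw [hJ, ← hI, Finset.coe_insert, PointedCone.hull, Submodule.mem_span_insert]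
    constructor
    · rintro ⟨a, z, hz, rfl⟩
      refine ⟨a, a.2, ?_⟩
      have : (a • v + z) - (a : ℝ) • v = z := by
        change ((a : ℝ) • v + z) - (a : ℝ) • v = z
        abel
      rw [this]
      exact hz
    · rintro ⟨t, ht, h⟩
      refine ⟨⟨t, ht⟩, _, h, ?_⟩
      change x = t • v + (x - t • v)
      abel

theorem halfspaceCone_inf_ker_isFaceOf (l : Module.Dual ℝ (Fin d → ℝ)) (hl : l ∈ I) :
    (halfspaceCone (V ⊓ LinearMap.ker l) I).IsFaceOf (halfspaceCone V I) := by
  refine PointedCone.IsFaceOf.of_mem_of_add_mem_left (fun x hx => ⟨hx.1.1, hx.2⟩) ?_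
  rintro x y hx hy ⟨⟨-, h⟩, -⟩
  rw [SetLike.mem_coe, LinearMap.mem_ker, map_add] at h
  have h1 := hx.2 l hl
  have h2 := hy.2 l hl
  exact ⟨⟨hx.1, by rw [SetLike.mem_coe, LinearMap.mem_ker]; linarith⟩, hx.2⟩

/-- Since every wall through `x` also contains `z`, the largest ratio `l z / l x` serves as `c`. If
`l x = 0`, then `l z = 0` and the ratio is the harmless value `0`; inserting `0` makes `c`
nonnegative, also for empty `I`. -/
theorem exists_smul_sub_mem_halfspaceCone {x z : Fin d → ℝ} (hx : x ∈ halfspaceCone V I)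
    (hz : z ∈ halfspaceCone V I) (h : ∀ l ∈ I, 0 < l z → 0 < l x) :
    ∃ c : ℝ, 0 ≤ c ∧ c • x - z ∈ halfspaceCone V I := by
  have hfin : (insert (0 : ℝ) ((fun l : Module.Dual ℝ (Fin d → ℝ) => l z / l x) ''
      (I : Set (Module.Dual ℝ (Fin d → ℝ))))).Finite := (I.finite_toSet.image _).insert 0
  obtain ⟨c, -, hmax⟩ := Set.exists_max_image _ id hfin ⟨0, Set.mem_insert _ _⟩
  refine ⟨c, hmax 0 (Set.mem_insert _ _), V.sub_mem (V.smul_mem c hx.1) hz.1, fun l hl => ?_⟩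
  have hc : 0 ≤ c := hmax 0 (Set.mem_insert _ _)
  rw [map_sub, map_smul, smul_eq_mul]
  rcases (hz.2 l hl).eq_or_lt with h0 | h0
  · rw [← h0, sub_zero]
    exact mul_nonneg hc (hx.2 l hl)
  · have := hmax _ (Set.mem_insert_of_mem _ ⟨l, hl, rfl⟩)
    simp only [id] at this
    rw [div_le_iff₀ (h l hl h0)] at this
    linarith

/-- A face that misses the point `z` is contained in a wall that misses `z`. -/
theorem exists_face_le_wall {D : RCone d} (hD : D.IsFaceOf (halfspaceCone V I))
    {z : Fin d → ℝ} (hz : z ∈ halfspaceCone V I) (hzD : z ∉ D) :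
    ∃ l ∈ I, 0 < l z ∧ D ≤ halfspaceCone (V ⊓ LinearMap.ker l) I := by
  by_contra! hcon
  have h1 : ∀ l : Module.Dual ℝ (Fin d → ℝ), ∃ x ∈ D, l ∈ I → 0 < l z → 0 < l x := by
    intro l
    by_cases hl : l ∈ I ∧ 0 < l z
    · obtain ⟨x, hx, hx'⟩ := SetLike.not_le_iff_exists.1 (hcon l hl.1 hl.2)
      refine ⟨x, hx, fun _ _ => lt_of_le_of_ne ((hD.le hx).2 l hl.1) fun h => hx' ?_⟩
      exact ⟨⟨(hD.le hx).1, LinearMap.mem_ker.2 h.symm⟩, (hD.le hx).2⟩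
    · exact ⟨0, D.zero_mem, fun h h' => absurd ⟨h, h'⟩ hl⟩
  choose x hxD hx using h1
  -- The sum lies in `D` and is off every wall that misses `z`, so some multiple of it is `z` plus a
  -- point of the cone. The face property then puts `z` in `D`.
  have hsum : ∑ l ∈ I, x l ∈ D := Submodule.sum_mem D fun l _ => hxD l
  obtain ⟨c, hc, h⟩ := exists_smul_sub_mem_halfspaceCone (hD.le hsum) hz fun l hl hlz => by
    rw [map_sum]
    exact Finset.sum_pos' (fun m _ => (hD.le (hxD m)).2 l hl) ⟨l, hl, hx l hl hlz⟩
  refine hzD (hD.mem_of_add_mem_left hz h ?_)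
  rw [add_sub_cancel]
  exact RCone.smul_mem hc hsum

/-- The functionals in `I` define exactly the facets of the cone `halfspaceCone V I`, which spans
`V`. -/
structure IsFacetSystem (V : Submodule ℝ (Fin d → ℝ))
    (I : Finset (Module.Dual ℝ (Fin d → ℝ))) : Prop where
  exists_pos : ∃ p ∈ V, ∀ l ∈ I, 0 < l p
  exists_facet_pos : ∀ l ∈ I, ∃ w ∈ V, l w = 0 ∧ ∀ m ∈ I, m ≠ l → 0 < m w

theorem halfspaceCone_anti {J : Finset (Module.Dual ℝ (Fin d → ℝ))} (h : J ⊆ I) :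
    halfspaceCone V I ≤ halfspaceCone V J := fun _ hx => ⟨hx.1, fun l hl => hx.2 l (h hl)⟩

/-- Take a subsystem of least cardinality. Dropping `l` from it enlarges the cone, so some `z`
violates `l` alone, and the segment from `z` to `p` crosses `ker l` where all other functionals are
positive. -/
theorem exists_isFacetSystem {p : Fin d → ℝ} (hpV : p ∈ V) (hp : ∀ l ∈ I, 0 < l p) :
    ∃ J ⊆ I, halfspaceCone V J = halfspaceCone V I ∧ IsFacetSystem V J := by
  classical
  have hne : (I.powerset.filter fun J => halfspaceCone V J = halfspaceCone V I).Nonempty :=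
    ⟨I, by simp⟩
  obtain ⟨J, hJ, hmin⟩ := Finset.exists_min_image _ Finset.card hne
  rw [Finset.mem_filter, Finset.mem_powerset] at hJ
  refine ⟨J, hJ.1, hJ.2, ⟨p, hpV, fun l hl => hp l (hJ.1 hl)⟩, fun l hl => ?_⟩
  have hlt : ¬ halfspaceCone V (J.erase l) ≤ halfspaceCone V J := by
    intro h
    have := hmin (J.erase l) (by
      rw [Finset.mem_filter, Finset.mem_powerset]
      exact ⟨(Finset.erase_subset _ _).trans hJ.1,
        (le_antisymm h (halfspaceCone_anti (Finset.erase_subset _ _))).trans hJ.2⟩)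
    exact absurd (Finset.card_erase_lt_of_mem hl) (not_lt.2 this)
  obtain ⟨z, hz, hz'⟩ := SetLike.not_le_iff_exists.1 hlt
  have hlz : l z < 0 := by
    by_contra! h
    refine hz' ⟨hz.1, fun m hm => ?_⟩
    by_cases hml : m = l
    · rw [hml]; exact h
    · exact hz.2 m (Finset.mem_erase.2 ⟨hml, hm⟩)
  have hlp := hp l (hJ.1 hl)
  -- A positive multiple of the crossing point: both coefficients `l p` and `-l z` are positive.
  refine ⟨l p • z - l z • p, V.sub_mem (V.smul_mem _ hz.1) (V.smul_mem _ hpV), ?_, ?_⟩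
  · simp [mul_comm]
  · intro m hm hml
    have h1 := mul_nonneg hlp.le (hz.2 m (Finset.mem_erase.2 ⟨hml, hm⟩))
    have h2 := mul_pos (neg_pos.2 hlz) (hp m (hJ.1 hm))
    simp only [map_sub, map_smul, smul_eq_mul]
    linarith

/-- Every proper face lies in a wall by `exists_face_le_wall`, and the points from
`exists_facet_pos` make distinct walls incomparable. -/
theorem IsFacetSystem.isFacetOrdering (h : IsFacetSystem V I) {n : ℕ}
    {e : Fin n → Module.Dual ℝ (Fin d → ℝ)} (he : Function.Injective e)
    (hI : ∀ l, l ∈ I ↔ ∃ k, e k = l) :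
    IsFacetOrdering (RCone.boundaryFan (halfspaceCone V I))
      (fun k => halfspaceCone (V ⊓ LinearMap.ker (e k)) I) := by
  obtain ⟨p, hpV, hp⟩ := h.exists_pos
  have heI : ∀ k, e k ∈ I := fun k => (hI _).2 ⟨k, rfl⟩
  have hle : ∀ k k', halfspaceCone (V ⊓ LinearMap.ker (e k)) I ≤
      halfspaceCone (V ⊓ LinearMap.ker (e k')) I → k = k' := by
    intro k k' hkk'
    obtain ⟨w, hwV, hw0, hw⟩ := h.exists_facet_pos (e k) (heI k)
    by_contra hne
    have hmem : w ∈ halfspaceCone (V ⊓ LinearMap.ker (e k)) I := by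
      refine ⟨⟨hwV, hw0⟩, fun m hm => ?_⟩
      by_cases hmk : m = e k
      · rw [hmk, hw0]
      · exact (hw m hm hmk).le
    have h0 : e k' w = 0 := (hkk' hmem).1.2
    have := hw (e k') (heI k') fun h => hne (he h).symm
    exact this.ne' h0
  have hbd : ∀ k, halfspaceCone (V ⊓ LinearMap.ker (e k)) I ∈
      RCone.boundaryFan (halfspaceCone V I) := by
    refine fun k => ⟨halfspaceCone_inf_ker_isFaceOf _ (heI k), fun heq => ?_⟩
    have hpC : p ∈ halfspaceCone V I := ⟨hpV, fun l hl => (hp l hl).le⟩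
    rw [← heq] at hpC
    exact (hp _ (heI k)).ne' hpC.1.2
  have hwall : ∀ D ∈ RCone.boundaryFan (halfspaceCone V I),
      ∃ k, D ≤ halfspaceCone (V ⊓ LinearMap.ker (e k)) I := by
    rintro D ⟨hD, hne⟩
    obtain ⟨z, hz, hzD⟩ := SetLike.not_le_iff_exists.1 fun h => hne (le_antisymm hD.le h)
    obtain ⟨l, hl, -, hDl⟩ := exists_face_le_wall hD hz hzD
    obtain ⟨k, rfl⟩ := (hI l).1 hl
    exact ⟨k, hDl⟩
  refine ⟨fun k k' hkk' => hle k k' hkk'.le, fun D => ⟨?_, fun hD => ?_⟩⟩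
  · rintro ⟨k, rfl⟩
    refine ⟨hbd k, fun D' hD' hkD => ?_⟩
    obtain ⟨k', hk'⟩ := hwall D' hD'
    rw [hle k k' (hkD.trans hk')]
    exact hk'
  · obtain ⟨k, hk⟩ := hwall D hD.prop
    exact ⟨k, le_antisymm (hD.le_of_ge (hbd k) hk) hk⟩

theorem eventually_add_mul_ne_zero {a b : ℝ} (hb : b ≠ 0) :
    ∀ᶠ ε in 𝓝[>] (0 : ℝ), a + ε * b ≠ 0 ∧ (a < 0 → a + ε * b < 0) := by
  have hc : Tendsto (fun ε : ℝ => a + ε * b) (𝓝[>] 0) (𝓝 a) := by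
    have : Tendsto (fun ε : ℝ => a + ε * b) (𝓝 0) (𝓝 (a + 0 * b)) :=
      (by fun_prop : Continuous fun ε : ℝ => a + ε * b).tendsto 0
    rw [zero_mul, add_zero] at this
    exact this.mono_left nhdsWithin_le_nhds
  rcases lt_trichotomy a 0 with ha | rfl | ha
  · filter_upwards [hc.eventually (gt_mem_nhds ha)] with ε hε
    exact ⟨hε.ne, fun _ => hε⟩
  · filter_upwards [self_mem_nhdsWithin] with ε hε
    refine ⟨?_, fun h => absurd h (lt_irrefl _)⟩
    rw [zero_add]
    exact mul_ne_zero (ne_of_gt hε) hb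
  · filter_upwards [hc.eventually (lt_mem_nhds ha)] with ε hε
    exact ⟨hε.ne', fun h => absurd h ha.not_gt⟩

/-- Near every point `y` there is a point at which the normalized functionals take pairwise
distinct values. -/
theorem IsFacetSystem.exists_generic (h : IsFacetSystem V I) {p y : Fin d → ℝ}
    (hp : ∀ l ∈ I, 0 < l p) (hy : y ∈ V) :
    ∃ q ∈ V, ∀ l ∈ I, ∀ m ∈ I, l ≠ m → l q / l p ≠ m q / m p ∧
      (l y < 0 → 0 ≤ m y → l q / l p < m q / m p) := by
  classical
  let f : {x : I × I // x.1 ≠ x.2} → Module.Dual ℝ (Fin d → ℝ) := fun x =>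
    (x.1.1.1 p)⁻¹ • x.1.1.1 - (x.1.2.1 p)⁻¹ • x.1.2.1
  have hf : ∀ x z, f x z = x.1.1.1 z / x.1.1.1 p - x.1.2.1 z / x.1.2.1 p := fun x z => by
    simp only [f, LinearMap.sub_apply, LinearMap.smul_apply, smul_eq_mul]
    ring
  -- Each difference of normalized functionals is nonzero on `V`, so finitely many of them have a
  -- common non-zero. A small move from `y` along this `z` separates all values and preserves strict
  -- inequalities.
  obtain ⟨z, hzV, hz⟩ := Module.Dual.exists_forall_mem_ne_zero_of_forall_exists V f (by
    rintro ⟨⟨l, m⟩, hlm⟩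
    obtain ⟨w, hwV, hw0, hw⟩ := h.exists_facet_pos l l.2
    refine ⟨w, hwV, ?_⟩
    rw [hf]
    have := div_pos (hw m m.2 fun h => hlm (Subtype.ext h.symm)) (hp m m.2)
    simp only [hw0, zero_div, zero_sub]
    exact (neg_neg_of_pos this).ne)
  have hev : ∀ᶠ ε in 𝓝[>] (0 : ℝ), ∀ x, f x y + ε * f x z ≠ 0 ∧
      (f x y < 0 → f x y + ε * f x z < 0) :=
    eventually_all.2 fun x => eventually_add_mul_ne_zero (hz x)
  obtain ⟨ε, hε⟩ := hev.exists
  refine ⟨y + ε • z, V.add_mem hy (V.smul_mem _ hzV), fun l hl m hm hlm => ?_⟩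
  have h1 := hε ⟨⟨⟨l, hl⟩, ⟨m, hm⟩⟩, fun h => hlm (Subtype.ext_iff.1 h)⟩
  have h2 : ∀ x, f x y + ε * f x z = f x (y + ε • z) := fun x => by simp
  rw [h2, hf, hf] at h1
  refine ⟨sub_ne_zero.1 h1.1, fun hly hmy => sub_neg.1 (h1.2 ?_)⟩
  have := div_neg_of_neg_of_pos hly (hp l hl)
  have := div_nonneg hmy (hp m hm).le
  simp only
  linarith

theorem Fin.exists_lt_iff_of_antitone {n : ℕ} {P : Fin n → Prop}
    (hP : ∀ i j, i < j → P j → P i) : ∃ r ≤ n, ∀ i : Fin n, (i : ℕ) < r ↔ P i := by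
  classical
  by_cases h : ∀ i, P i
  · exact ⟨n, le_rfl, fun i => ⟨fun _ => h i, fun _ => i.2⟩⟩
  · push Not at h
    obtain ⟨i, hi, hmin⟩ := Set.exists_min_image {i | ¬ P i} id (Set.toFinite _) h
    refine ⟨i, i.2.le, fun k => ⟨fun hk => ?_, fun hk => ?_⟩⟩
    · by_contra hPk
      exact absurd (hmin k hPk) (not_le.2 hk)
    · by_contra! hik
      rcases (show i ≤ k from hik).eq_or_lt with rfl | hlt
      · exact hi hk
      · exact hi (hP i k hlt hk)

theorem Finset.exists_enumeration_strictMono {α : Type*} (I : Finset α) (c : α → ℝ)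
    (hc : Set.InjOn c I) : ∃ e : Fin I.card → α, StrictMono (c ∘ e) ∧
      ∀ l, l ∈ I ↔ ∃ k, e k = l := by
  classical
  have hcard : (I.image c).card = I.card := Finset.card_image_of_injOn hc
  have hex : ∀ k : Fin I.card, ∃ l ∈ I, c l = (I.image c).orderEmbOfFin hcard k := fun k =>
    Finset.mem_image.1 (Finset.orderEmbOfFin_mem _ hcard k)
  choose e heI he using hex
  refine ⟨e, fun k k' hk => ?_, fun l => ⟨fun hl => ?_, ?_⟩⟩
  · simp only [Function.comp, he]
    exact ((I.image c).orderEmbOfFin hcard).strictMono hk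
  · have : c l ∈ Set.range ((I.image c).orderEmbOfFin hcard) := by
      rw [Finset.range_orderEmbOfFin]
      exact Finset.mem_coe.2 (Finset.mem_image_of_mem _ hl)
    obtain ⟨k, hk⟩ := this
    exact ⟨k, hc (heI k) hl ((he k).trans hk)⟩
  · rintro ⟨k, rfl⟩
    exact heI k

end HalfspaceCone

/-! ### Line shellings of the boundary of a cone -/

section LineShelling

variable {d : ℕ} {V : Submodule ℝ (Fin d → ℝ)} {I : Finset (Module.Dual ℝ (Fin d → ℝ))}

theorem halfspaceCone_inf_ker_inf (l m : Module.Dual ℝ (Fin d → ℝ)) :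
    halfspaceCone (V ⊓ LinearMap.ker l ⊓ LinearMap.ker m) I =
      halfspaceCone (V ⊓ LinearMap.ker l) I ⊓ halfspaceCone (V ⊓ LinearMap.ker m) I := by
  ext x
  exact ⟨fun hx => ⟨⟨hx.1.1, hx.2⟩, ⟨hx.1.1.1, hx.1.2⟩, hx.2⟩,
    fun hx => ⟨⟨hx.1.1, hx.2.1.2⟩, hx.1.2⟩⟩

/-- If leaving the cone from `x` in direction `y`, one crosses a wall that separates the cone
from `y`. -/
theorem exists_wall_of_forall_add_notMem {x y : Fin d → ℝ} (hx : x ∈ halfspaceCone V I)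
    (hy : y ∈ V) (h : ∀ ε : ℝ, 0 < ε → x + ε • y ∉ halfspaceCone V I) :
    ∃ l ∈ I, l x = 0 ∧ l y < 0 := by
  by_contra! hcon
  have hev : ∀ᶠ ε in 𝓝[>] (0 : ℝ), ∀ l ∈ I, 0 ≤ l x + ε * l y := by
    rw [Finset.eventually_all]
    intro l hl
    rcases (hx.2 l hl).eq_or_lt with h0 | h0
    · filter_upwards [self_mem_nhdsWithin] with ε hε
      rw [← h0, zero_add]
      exact mul_nonneg (le_of_lt hε) (hcon l hl h0.symm)
    · have hc : Tendsto (fun ε : ℝ => l x + ε * l y) (𝓝 0) (𝓝 (l x + 0 * l y)) :=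
        (by fun_prop : Continuous fun ε : ℝ => l x + ε * l y).tendsto 0
      rw [zero_mul, add_zero] at hc
      filter_upwards [(hc.mono_left nhdsWithin_le_nhds).eventually (lt_mem_nhds h0)] with ε hε
      exact hε.le
  obtain ⟨ε, hε, hpos⟩ := (hev.and self_mem_nhdsWithin).exists
  refine h ε hpos ⟨V.add_mem hx.1 (V.smul_mem _ hy), fun l hl => ?_⟩
  rw [map_add, map_smul]
  exact hε l hl

/-- The part of the facet on `l` covered by walls of `I` that separate the cone from the point `y`
of the span of the facet, in terms of the facets `J` of that facet. -/
theorem iUnion_fan_inter_fan {J : Finset (Module.Dual ℝ (Fin d → ℝ))}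
    {l : Module.Dual ℝ (Fin d → ℝ)} {y : Fin d → ℝ} (hl : l ∈ I)
    (hJI : J ⊆ I) (hJ : halfspaceCone (V ⊓ LinearMap.ker l) J =
      halfspaceCone (V ⊓ LinearMap.ker l) I) (hy : y ∈ V ⊓ LinearMap.ker l) (D : RCone d) :
    (∃ m ∈ I, m y < 0 ∧ D ∈ (halfspaceCone (V ⊓ LinearMap.ker m) I).fan ∧
      D ∈ (halfspaceCone (V ⊓ LinearMap.ker l) I).fan) ↔
    ∃ m ∈ J, m y < 0 ∧ D ∈ (halfspaceCone (V ⊓ LinearMap.ker l ⊓ LinearMap.ker m) J).fan := by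
  have hinf : ∀ m : Module.Dual ℝ (Fin d → ℝ),
      halfspaceCone (V ⊓ LinearMap.ker l ⊓ LinearMap.ker m) J =
      halfspaceCone (V ⊓ LinearMap.ker l) I ⊓ halfspaceCone (V ⊓ LinearMap.ker m) I := by
    intro m
    rw [← halfspaceCone_inf_ker_inf]
    ext x
    refine ⟨fun hx => ⟨hx.1, ?_⟩, fun hx => ⟨hx.1, fun k hk => hx.2 k (hJI hk)⟩⟩
    have : x ∈ halfspaceCone (V ⊓ LinearMap.ker l) J := ⟨hx.1.1, hx.2⟩
    rw [hJ] at this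
    exact this.2
  have hface : ∀ m ∈ I, (halfspaceCone (V ⊓ LinearMap.ker m) I).IsFaceOf (halfspaceCone V I) :=
    fun m hm => halfspaceCone_inf_ker_isFaceOf m hm
  constructor
  · rintro ⟨m, hm, hmy, hDm, hDl⟩
    change PointedCone.IsFaceOf _ _ at hDm hDl
    suffices h : ∃ k ∈ J, k y < 0 ∧ D ≤ LinearMap.ker k by
      obtain ⟨k, hk, hky, hDk⟩ := h
      refine ⟨k, hk, hky, ?_⟩
      change PointedCone.IsFaceOf _ _
      rw [hinf]
      refine (PointedCone.IsFaceOf.isFaceOf_iff_le (hDl.trans (hface l hl))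
        ((hface l hl).inf_left (hface k (hJI hk)))).2 fun x hx => ⟨hDl.le hx, ?_⟩
      exact ⟨⟨(hDl.le hx).1.1, hDk hx⟩, (hDl.le hx).2⟩
    by_contra! hcon
    have h1 : ∀ k : Module.Dual ℝ (Fin d → ℝ), ∃ x ∈ D, k ∈ J → k y < 0 → 0 < k x := by
      intro k
      by_cases hk : k ∈ J ∧ k y < 0
      · obtain ⟨x, hx, hx'⟩ := SetLike.not_le_iff_exists.1 (hcon k hk.1 hk.2)
        exact ⟨x, hx, fun _ _ => lt_of_le_of_ne ((hDl.le hx).2 k (hJI hk.1)) fun h => hx' h.symm⟩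
      · exact ⟨0, D.zero_mem, fun h h' => absurd ⟨h, h'⟩ hk⟩
    choose x hxD hx using h1
    -- This point of `D` is strictly inside every wall of `J` that is negative at `y`, so a short
    -- move towards `y` should stay in the facet. But `m` vanishes there and is negative at `y`, so
    -- the move leaves the cone.
    have hsum : ∑ k ∈ J, x k ∈ D := Submodule.sum_mem D fun k _ => hxD k
    have hsum0 : m (∑ k ∈ J, x k) = 0 := (hDm.le hsum).1.2
    obtain ⟨k, hk, hk0, hky⟩ := exists_wall_of_forall_add_notMem (I := J) (y := y)
      (hJ ▸ hDl.le hsum) hy (fun ε hε hmem => by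
        rw [hJ] at hmem
        have := hmem.2 m hm
        rw [map_add, map_smul, hsum0, zero_add, smul_eq_mul] at this
        exact absurd (mul_neg_of_pos_of_neg hε hmy) (not_lt.2 this))
    rw [map_sum] at hk0
    exact absurd hk0 (Finset.sum_pos' (fun i _ => (hDl.le (hxD i)).2 k (hJI hk))
      ⟨k, hk, hx k hk hky⟩).ne'
  · rintro ⟨m, hm, hmy, hD⟩
    change PointedCone.IsFaceOf _ _ at hD
    rw [hinf] at hD
    have hf := (hface l hl).inf_left (hface m (hJI hm))
    exact ⟨m, hJI hm, hmy,
      hD.trans ((PointedCone.IsFaceOf.isFaceOf_iff_le hf (hface m (hJI hm))).2 inf_le_right),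
      hD.trans ((PointedCone.IsFaceOf.isFaceOf_iff_le hf (hface l hl)).2 inf_le_left)⟩

/-- The Bruggesser–Mani line shelling: the boundary of a polyhedral cone has a shelling that begins
with the facets visible from `y`. -/
theorem IsFacetSystem.exists_shelling (h : IsFacetSystem V I) {y : Fin d → ℝ} (hy : y ∈ V) :
    ∃ e : Fin I.card → Module.Dual ℝ (Fin d → ℝ), (∀ l, l ∈ I ↔ ∃ k, e k = l) ∧
      (∃ r ≤ I.card, ∀ k : Fin I.card, (k : ℕ) < r ↔ e k y < 0) ∧
      IsShelling (RCone.boundaryFan (halfspaceCone V I))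
        (fun k => halfspaceCone (V ⊓ LinearMap.ker (e k)) I) := by
  classical
  induction hn : I.card using Nat.strong_induction_on generalizing V I y with
  | _ n ih =>
  subst hn
  obtain ⟨p, hpV, hp⟩ := h.exists_pos
  obtain ⟨q, hqV, hq⟩ := h.exists_generic hp hy
  -- The order in which the line through `q` with direction `p` meets the hyperplanes of the facets.
  -- As `q` is a generic point near `y`, the facets visible from `y` come first.
  obtain ⟨e, hmono, hI⟩ := Finset.exists_enumeration_strictMono I (fun l => l q / l p)
    (fun l hl m hm hlm => by
      by_contra hne
      exact (hq l hl m hm hne).1 hlm)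
  have heI : ∀ k, e k ∈ I := fun k => (hI _).2 ⟨k, rfl⟩
  have heinj : Function.Injective e := fun i j hij => hmono.injective (by simp [hij])
  refine ⟨e, hI, ?_, ?_⟩
  · refine Fin.exists_lt_iff_of_antitone fun i j hij hj => ?_
    by_contra! hi
    have := (hq (e j) (heI j) (e i) (heI i) fun h => hij.ne' (heinj h)).2 hj hi
    exact absurd (hmono hij) (not_lt.2 this.le)
  have hex : ∀ k, ∃ J ⊆ I.erase (e k), halfspaceCone (V ⊓ LinearMap.ker (e k)) J =
      halfspaceCone (V ⊓ LinearMap.ker (e k)) (I.erase (e k)) ∧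
      IsFacetSystem (V ⊓ LinearMap.ker (e k)) J := by
    intro k
    obtain ⟨w, hwV, hw0, hw⟩ := h.exists_facet_pos (e k) (heI k)
    exact exists_isFacetSystem (p := w) ⟨hwV, hw0⟩ fun m hm =>
      hw m (Finset.mem_of_mem_erase hm) (Finset.ne_of_mem_erase hm)
  choose J hJ hJe hJs using hex
  have hJI : ∀ k, J k ⊆ I := fun k => (hJ k).trans (Finset.erase_subset _ _)
  have hJC : ∀ k, halfspaceCone (V ⊓ LinearMap.ker (e k)) (J k) =
      halfspaceCone (V ⊓ LinearMap.ker (e k)) I := by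
    intro k
    rw [hJe]
    refine le_antisymm (fun x hx => ⟨hx.1, fun m hm => ?_⟩) (halfspaceCone_anti
      (Finset.erase_subset _ _))
    by_cases hmk : m = e k
    · rw [hmk, show e k x = 0 from hx.1.2]
    · exact hx.2 m (Finset.mem_erase.2 ⟨hmk, hm⟩)
  have hcard : ∀ k, (J k).card < I.card := fun k =>
    (Finset.card_le_card (hJ k)).trans_lt (Finset.card_erase_lt_of_mem (heI k))
  -- The point where the line meets `ker (e k)`. The functionals negative there are exactly the
  -- earlier ones, so the induction hypothesis for facet `k`, viewed from `z k`, starts its shelling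
  -- with the part covered by earlier facets.
  let z : Fin I.card → (Fin d → ℝ) := fun k => q - (e k q / e k p) • p
  have hz : ∀ k, z k ∈ V ⊓ LinearMap.ker (e k) := fun k => by
    refine ⟨V.sub_mem hqV (V.smul_mem _ hpV), ?_⟩
    have := (hp _ (heI k)).ne'
    simp only [z, SetLike.mem_coe, LinearMap.mem_ker, map_sub, map_smul, smul_eq_mul]
    field_simp
    ring
  have hzneg : ∀ i k, e i (z k) < 0 ↔ i < k := by
    intro i k
    have hpi := hp _ (heI i)
    rw [← hmono.lt_iff_lt (a := i) (b := k)]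
    simp only [z, map_sub, map_smul, smul_eq_mul, Function.comp, sub_neg]
    rw [div_lt_iff₀ hpi]
  choose e' he' hr' hsh using fun k => ih _ (hcard k) (hJs k) (hz k) rfl
  choose r hr hre using hr'
  have hinter : ∀ j : Fin I.card,
      (⋃ i : Fin I.card, ⋃ _ : i < j, (halfspaceCone (V ⊓ LinearMap.ker (e i)) I).fan ∩
        (halfspaceCone (V ⊓ LinearMap.ker (e j)) I).fan) =
      ⋃ k : Fin (J j).card, ⋃ _ : (k : ℕ) < r j,
        (halfspaceCone (V ⊓ LinearMap.ker (e j) ⊓ LinearMap.ker (e' j k)) (J j)).fan := by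
    intro j
    ext D
    have := iUnion_fan_inter_fan (heI j) (hJI j) (hJC j) (hz j) D
    simp only [Set.mem_iUnion, Set.mem_inter_iff, exists_prop]
    constructor
    · rintro ⟨i, hij, h1, h2⟩
      obtain ⟨m, hm, hmy, hD⟩ := this.1 ⟨e i, heI i, (hzneg i j).2 hij, h1, h2⟩
      obtain ⟨k, rfl⟩ := (he' j m).1 hm
      exact ⟨k, (hre j k).2 hmy, hD⟩
    · rintro ⟨k, hk, hD⟩
      obtain ⟨m, hm, hmy, h1, h2⟩ := this.2 ⟨e' j k, (he' j _).2 ⟨k, rfl⟩, (hre j k).1 hk, hD⟩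
      obtain ⟨i, rfl⟩ := (hI m).1 hm
      exact ⟨i, (hzneg i j).1 hmy, h1, h2⟩
  -- For empty `I` this is the empty ordering, so the induction needs no separate base case.
  refine IsShelling.step (h.isFacetOrdering heinj hI) (fun k => (J k).card)
    (fun k i => halfspaceCone (V ⊓ LinearMap.ker (e k) ⊓ LinearMap.ker (e' k i)) (J k))
    (fun k => hJC k ▸ hsh k) fun j hj => ?_
  have hne : (⋃ i : Fin I.card, ⋃ _ : i < j, (halfspaceCone (V ⊓ LinearMap.ker (e i)) I).fan ∩
        (halfspaceCone (V ⊓ LinearMap.ker (e j)) I).fan).Nonempty := by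
    refine ⟨(halfspaceCone V I).lineal, Set.mem_iUnion₂.2 ⟨⟨0, hj.trans j.2⟩, hj, ?_⟩⟩
    have hlin : ∀ k, PointedCone.IsFaceOf ((halfspaceCone V I).lineal : RCone d)
        (halfspaceCone (V ⊓ LinearMap.ker (e k)) I) := fun k => by
      have hf := halfspaceCone_inf_ker_isFaceOf (V := V) (e k) (heI k)
      exact (PointedCone.IsFaceOf.isFaceOf_iff_le (PointedCone.IsFaceOf.lineal _) hf).2 hf.lineal_le
    exact ⟨hlin _, hlin _⟩
  refine ⟨hne, r j, ?_, hr j, hinter j⟩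
  rw [hinter] at hne
  obtain ⟨D, hD⟩ := hne
  obtain ⟨k, hk, -⟩ := Set.mem_iUnion₂.1 hD
  omega

/-- The boundary of a finitely generated cone has a shelling that begins with the facets not
containing a given point of the cone. -/
theorem exists_shelling_boundaryFan (s : Finset (Fin d → ℝ)) {z : Fin d → ℝ}
    (hz : z ∈ PointedCone.hull ℝ (s : Set (Fin d → ℝ))) :
    ∃ (t : ℕ) (D : Fin t → RCone d) (r : ℕ),
      IsShelling (RCone.boundaryFan (PointedCone.hull ℝ (s : Set (Fin d → ℝ)))) D ∧ r ≤ t ∧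
      (⋃ l : Fin t, ⋃ _ : (l : ℕ) < r, (D l).fan) =
        {F | F ∈ RCone.fan (PointedCone.hull ℝ (s : Set (Fin d → ℝ))) ∧ z ∉ F} := by
  classical
  obtain ⟨I₀, hI₀⟩ := exists_halfspaceCone_eq_hull s
  rw [hI₀] at hz ⊢
  let V : Submodule ℝ (Fin d → ℝ) := Submodule.span ℝ (halfspaceCone ⊤ I₀ : Set (Fin d → ℝ))
  -- The discarded functionals vanish on the whole cone. For each of the rest some point of the cone
  -- is positive, and the sum of these points is positive for all of them.
  let I := I₀.filter fun l => ∃ x ∈ halfspaceCone ⊤ I₀, 0 < l x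
  have hI : halfspaceCone ⊤ I₀ = halfspaceCone V I := by
    refine le_antisymm (fun x hx => ⟨Submodule.subset_span hx, fun l hl =>
      hx.2 l (Finset.mem_filter.1 hl).1⟩) fun x hx => ⟨trivial, fun l hl => ?_⟩
    by_cases hlI : l ∈ I
    · exact hx.2 l hlI
    · have hV : V ≤ LinearMap.ker l := Submodule.span_le.2 fun w hw => by
        refine le_antisymm ?_ (hw.2 l hl)
        by_contra! h
        exact hlI (Finset.mem_filter.2 ⟨hl, w, hw, h⟩)
      exact (LinearMap.mem_ker.1 (hV hx.1)).ge
  have hpos : ∀ l : Module.Dual ℝ (Fin d → ℝ), ∃ x ∈ halfspaceCone ⊤ I₀, l ∈ I → 0 < l x := by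
    intro l
    by_cases hl : l ∈ I
    · obtain ⟨-, x, hx, hlx⟩ := Finset.mem_filter.1 hl
      exact ⟨x, hx, fun _ => hlx⟩
    · exact ⟨0, Submodule.zero_mem _, fun h => absurd h hl⟩
  choose x hxC hx using hpos
  obtain ⟨J, hJI, hJ, hJs⟩ := exists_isFacetSystem (V := V) (I := I) (p := ∑ l ∈ I, x l)
    (Submodule.sum_mem _ fun l _ => Submodule.subset_span (hxC l)) fun l hl => by
      rw [map_sum]
      exact Finset.sum_pos' (fun m _ => (hxC m).2 l (Finset.mem_filter.1 hl).1) ⟨l, hl, hx l hl⟩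
  rw [hI, ← hJ] at hz ⊢
  -- Viewing from `-z`: a facet is visible exactly when its functional is positive at `z`, that is,
  -- when it misses `z`.
  obtain ⟨e, he, ⟨r, hr, hre⟩, hsh⟩ := hJs.exists_shelling (V.neg_mem hz.1)
  refine ⟨_, _, r, hsh, hr, ?_⟩
  ext F
  simp only [Set.mem_iUnion, exists_prop, Set.mem_ofPred_eq]
  constructor
  · rintro ⟨k, hk, hF⟩
    refine ⟨PointedCone.IsFaceOf.trans hF (halfspaceCone_inf_ker_isFaceOf _ ((he _).2 ⟨k, rfl⟩)),
      fun hzF => ?_⟩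
    have h0 : e k z = 0 := (PointedCone.IsFaceOf.le hF hzF).1.2
    have := (hre k).1 hk
    rw [map_neg, h0, neg_zero] at this
    exact lt_irrefl _ this
  · rintro ⟨hF, hzF⟩
    obtain ⟨l, hl, hlz, hFl⟩ := exists_face_le_wall hF hz hzF
    obtain ⟨k, rfl⟩ := (he l).1 hl
    refine ⟨k, (hre k).2 (by rw [map_neg]; linarith), ?_⟩
    exact (PointedCone.IsFaceOf.isFaceOf_iff_le hF (halfspaceCone_inf_ker_isFaceOf _ hl)).2 hFl

end LineShelling

/-! ### Relative interiors and generic lattice points -/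

section Relint

variable {d : ℕ}

theorem RCone.IsRational.exists_finset {C : RCone d} (hC : C.IsRational) :
    ∃ s : Finset (Fin d → ℝ), C = PointedCone.hull ℝ (s : Set (Fin d → ℝ)) := by
  classical
  obtain ⟨s, rfl⟩ := hC
  exact ⟨s.image latticeVec, by rw [Finset.coe_image]⟩

/-- Every point of a rational cone lies in the relative interior of a face. -/
theorem RCone.IsRational.exists_mem_intrinsicInterior {C : RCone d} (hC : C.IsRational)
    {x : Fin d → ℝ} (hx : x ∈ C) :
    ∃ D : RCone d, D.IsFaceOf C ∧ x ∈ intrinsicInterior ℝ (D : Set (Fin d → ℝ)) := by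
  classical
  obtain ⟨s, rfl⟩ := hC.exists_finset
  obtain ⟨I, hI⟩ := exists_halfspaceCone_eq_hull s
  rw [hI] at hx ⊢
  -- The face is cut out by the functionals that vanish at `x`; the others are positive at `x`, an
  -- open condition.
  let V : Submodule ℝ (Fin d → ℝ) := ⨅ l ∈ I.filter fun l => l x = 0, LinearMap.ker l
  have hV : ∀ z, z ∈ V ↔ ∀ l ∈ I, l x = 0 → l z = 0 := fun z => by
    simp [V, Submodule.mem_iInf]
  have hxD : x ∈ halfspaceCone V I := ⟨(hV x).2 fun l _ h => h, hx.2⟩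
  refine ⟨halfspaceCone V I, PointedCone.IsFaceOf.of_mem_of_add_mem_left
    (fun z hz => ⟨trivial, hz.2⟩) ?_, ?_⟩
  · rintro z w hz hw ⟨hzw, -⟩
    refine ⟨(hV z).2 fun l hl hlx => ?_, hz.2⟩
    have h0 := (hV _).1 hzw l hl hlx
    rw [map_add] at h0
    have h1 := hz.2 l hl
    have h2 := hw.2 l hl
    linarith
  · rw [mem_intrinsicInterior]
    refine ⟨⟨x, subset_affineSpan ℝ _ hxD⟩, mem_interior.2 ⟨{z | ∀ l ∈ I, l x ≠ 0 →
      0 < l (z : Fin d → ℝ)}, fun z hz => ?_, ?_, fun l hl hlx => ?_⟩, rfl⟩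
    · have hzV : (z : Fin d → ℝ) ∈ V := by
        have hle : affineSpan ℝ (halfspaceCone V I : Set (Fin d → ℝ)) ≤ V.toAffineSubspace :=
          affineSpan_le.2 fun w hw => hw.1
        exact hle z.2
      refine ⟨hzV, fun l hl => ?_⟩
      by_cases hlx : l x = 0
      · rw [(hV _).1 hzV l hl hlx]
      · exact (hz l hl hlx).le
    · have hset : {z : affineSpan ℝ (halfspaceCone V I : Set (Fin d → ℝ)) | ∀ l ∈ I, l x ≠ 0 →
          0 < l (z : Fin d → ℝ)} = ⋂ l ∈ I.filter fun l => l x ≠ 0,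
            {z : affineSpan ℝ (halfspaceCone V I : Set (Fin d → ℝ)) |
              0 < l (z : Fin d → ℝ)} := by
        ext z
        simp
      rw [hset]
      refine isOpen_biInter_finset fun l _ => isOpen_lt continuous_const ?_
      exact l.continuous_of_finiteDimensional.comp continuous_subtype_val
    · exact lt_of_le_of_ne (hx.2 l hl) (Ne.symm hlx)

/-- A face containing a relatively interior point is the whole cone. -/
theorem PointedCone.IsFaceOf.le_of_mem_intrinsicInterior {F D : RCone d} (hF : F.IsFaceOf D)
    {x : Fin d → ℝ} (hx : x ∈ intrinsicInterior ℝ (D : Set (Fin d → ℝ))) (hxF : x ∈ F) :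
    D ≤ F := by
  intro z hz
  rw [mem_intrinsicInterior] at hx
  obtain ⟨x, hx, rfl⟩ := hx
  have hz' : z ∈ affineSpan ℝ (D : Set (Fin d → ℝ)) := subset_affineSpan ℝ _ hz
  let g : ℝ → affineSpan ℝ (D : Set (Fin d → ℝ)) := fun t =>
    ⟨AffineMap.lineMap (x : Fin d → ℝ) z t, AffineMap.lineMap_mem t x.2 hz'⟩
  have hg : Continuous g := Continuous.subtype_mk (by fun_prop) _
  have hg0 : g 0 = x := Subtype.ext (by simp [g])
  have hev : ∀ᶠ t in 𝓝 (0 : ℝ), g t ∈ interior ((↑) ⁻¹' (D : Set (Fin d → ℝ)) :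
      Set (affineSpan ℝ (D : Set (Fin d → ℝ)))) :=
    hg.continuousAt.eventually_mem (by rw [hg0]; exact isOpen_interior.mem_nhds hx)
  -- With `t < 0` the segment from `z` is prolonged slightly beyond `x` inside `D`. A positive
  -- multiple of `x` is then a sum of points of `D` with a positive multiple of `z` as a summand.
  obtain ⟨t, ht, ht0⟩ := ((hev.filter_mono nhdsWithin_le_nhds).and
    (self_mem_nhdsWithin : Set.Iio (0 : ℝ) ∈ 𝓝[<] 0)).exists
  have ht' : AffineMap.lineMap (x : Fin d → ℝ) z t ∈ D :=
    (interior_subset : _ ⊆ ((↑) ⁻¹' (D : Set (Fin d → ℝ)) :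
      Set (affineSpan ℝ (D : Set (Fin d → ℝ))))) ht
  have ht0 : t < 0 := ht0
  refine hF.mem_of_smul_add_mem (a := -t) hz ht' (neg_pos.2 ht0) ?_
  have : -t • z + AffineMap.lineMap (x : Fin d → ℝ) z t = (1 - t) • (x : Fin d → ℝ) := by
    rw [AffineMap.lineMap_apply_module]
    module
  rw [this]
  exact RCone.smul_mem (by linarith) hxF

/-- A rational cone contains a lattice point that lies in no proper face. -/
theorem RCone.IsRational.exists_latticePoint {D : RCone d} (hD : D.IsRational) :
    ∃ a ∈ D.latticePoints, ∀ F : RCone d, F.IsFaceOf D → latticeVec a ∈ F → D ≤ F := by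
  obtain ⟨s, rfl⟩ := hD
  have hsum : latticeVec (∑ b ∈ s, b) = ∑ b ∈ s, latticeVec b := by
    funext i
    simp [latticeVec]
  have hs : ∀ b ∈ s, latticeVec b ∈ PointedCone.hull ℝ (latticeVec '' (s : Set (Fin d → ℤ))) :=
    fun b hb => Submodule.subset_span ⟨b, hb, rfl⟩
  -- A face containing the sum of the generators contains every generator.
  refine ⟨∑ b ∈ s, b, ?_, fun F hF hmem => ?_⟩
  · change latticeVec _ ∈ PointedCone.hull ℝ (latticeVec '' (s : Set (Fin d → ℤ)))
    rw [hsum]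
    exact Submodule.sum_mem _ hs
  · refine Submodule.span_le.2 ?_
    rintro _ ⟨b, hb, rfl⟩
    rw [hsum, ← Finset.sum_coe_sort] at hmem
    exact hF.mem_of_sum_mem (f := fun b : s => latticeVec b.1) (fun b => hs b b.2) hmem ⟨b, hb⟩

end Relint

/-! ### New lattice points of a facet ordering, and shellability -/

namespace RationalPointedFan

variable {d : ℕ} {S : RationalPointedFan d}

theorem mem_cones_of_isFaceOf {C D : RCone d} (hC : C ∈ S.cones) (hD : D.IsFaceOf C) :
    D ∈ S.cones := (S.face_iff C hC D hD.le).1 hD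

theorem isFaceOf_of_le {C D : RCone d} (hC : C ∈ S.cones) (hD : D ∈ S.cones) (h : D ≤ C) :
    D.IsFaceOf C := (S.face_iff C hC D h).2 hD

theorem le_of_latticePoints_subset {C D : RCone d} (hC : C ∈ S.cones) (hD : D ∈ S.cones)
    (h : D.latticePoints ⊆ C.latticePoints) : D ≤ C := by
  obtain ⟨a, ha, hgen⟩ := (S.rational D hD).exists_latticePoint
  exact (hgen _ (S.inter_face D hD C hC).1 ⟨ha, h ha⟩).trans inf_le_right

/-- Pointedness: the monoid of lattice points has no units besides `0`. This makes divisibility of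
exponents a partial order. -/
theorem eq_zero_of_mem_of_neg_mem {C : RCone d} (hC : C ∈ S.cones) {a b : Fin d → ℤ}
    (ha : a ∈ C.latticePoints) (hb : b ∈ C.latticePoints) (h : a + b = 0) : b = 0 := by
  by_contra hne
  have hb0 : latticeVec b ≠ 0 := fun h0 => hne <| funext fun i => by
    have : (b i : ℝ) = 0 := congrFun h0 i
    exact_mod_cast this
  refine S.pointed C hC _ hb hb0 ?_
  have hab : latticeVec a + latticeVec b = 0 := by
    rw [← latticeVec_add, h, latticeVec_zero]
  rw [← eq_neg_of_add_eq_zero_left hab]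
  exact ha

theorem exists_maximal_le {C : RCone d} (hC : C ∈ S.cones) :
    ∃ D, Maximal (· ∈ S.cones) D ∧ C ≤ D := by
  obtain ⟨D, hD, hmax⟩ := S.finite.exists_le_maximal hC
  exact ⟨D, hmax, hD⟩

/-- The lattice points of `C j` that lie in none of the cones `C i` with `i < j`. -/
def newPoints {s : ℕ} (C : Fin s → RCone d) (j : Fin s) : Set (Fin d → ℤ) :=
  {a | a ∈ (C j).latticePoints ∧ ∀ i < j, a ∉ (C i).latticePoints}

/-- A point `a` in the relative interior of a face `D` lies in `C i` only if all of `D` does. Hence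
`a` is new exactly when `D` is. -/
theorem iUnion_relintLatticePoints_eq_newPoints {s : ℕ} {C : Fin s → RCone d}
    (hC : ∀ i, C i ∈ S.cones) {j : Fin s} {γ : Fin d → ℤ}
    (hstar : latticeStar (C j).fan γ = (C j).fan \ ⋃ i : Fin s, ⋃ _ : i < j, (C i).fan) :
    (⋃ D ∈ latticeStar (C j).fan γ, D.relintLatticePoints) = newPoints C j := by
  rw [hstar]
  ext a
  simp only [Set.mem_iUnion, exists_prop, Set.mem_sdiff, not_exists, not_and]
  constructor
  · rintro ⟨D, ⟨hD, hnew⟩, ha⟩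
    have haD : latticeVec a ∈ D := intrinsicInterior_subset ha
    refine ⟨PointedCone.IsFaceOf.le hD haD, fun i hi hai => hnew i hi ?_⟩
    have hDS := mem_cones_of_isFaceOf (hC j) hD
    have hle := (S.inter_face D hDS (C i) (hC i)).1.le_of_mem_intrinsicInterior ha ⟨haD, hai⟩
    exact isFaceOf_of_le (hC i) hDS (hle.trans inf_le_right)
  · rintro ⟨ha, hnew⟩
    obtain ⟨D, hD, haD⟩ := (S.rational _ (hC j)).exists_mem_intrinsicInterior ha
    refine ⟨D, ⟨hD, fun i hi hDi => hnew i hi ?_⟩, haD⟩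
    exact PointedCone.IsFaceOf.le hDi (intrinsicInterior_subset haD)

/-- Since `γ` is itself new, so is every face containing it. Conversely, a new face has a generic
lattice point, which is new and hence equal to `γ + m`; the face property recovers `γ`. -/
theorem latticeStar_eq_of_newPoints_eq {s : ℕ} {C : Fin s → RCone d}
    (hC : ∀ i, C i ∈ S.cones) {j : Fin s} {γ : Fin d → ℤ}
    (h : newPoints C j = (fun a => γ + a) '' (C j).latticePoints) :
    latticeStar (C j).fan γ = (C j).fan \ ⋃ i : Fin s, ⋃ _ : i < j, (C i).fan := by
  have h0 : (0 : Fin d → ℤ) ∈ (C j).latticePoints := by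
    change latticeVec 0 ∈ C j
    rw [latticeVec_zero]
    exact Submodule.zero_mem _
  have hγ : γ ∈ newPoints C j := by
    rw [h]
    exact ⟨0, h0, add_zero γ⟩
  ext D
  simp only [latticeStar, Set.mem_ofPred_eq, Set.mem_iUnion, exists_prop, Set.mem_sdiff, not_exists,
    not_and]
  refine and_congr_right fun hD => ⟨fun hγD i hi hDi => hγ.2 i hi (PointedCone.IsFaceOf.le hDi hγD),
    fun hnew => ?_⟩
  have hDS := mem_cones_of_isFaceOf (hC j) hD
  obtain ⟨a, ha, hgen⟩ := (S.rational D hDS).exists_latticePoint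
  have haT : a ∈ newPoints C j := by
    refine ⟨PointedCone.IsFaceOf.le hD ha, fun i hi hai => hnew i hi ?_⟩
    exact isFaceOf_of_le (hC i) hDS
      ((hgen _ (S.inter_face D hDS (C i) (hC i)).1 ⟨ha, hai⟩).trans inf_le_right)
  rw [h] at haT
  obtain ⟨m, hm, rfl⟩ := haT
  change latticeVec (γ + m) ∈ D at ha
  rw [latticeVec_add] at ha
  exact PointedCone.IsFaceOf.mem_of_add_mem_left hD hγ.1 hm ha

/-- The faces of `C j` in earlier facets are those missing `γ j`, and some line shelling of the
boundary begins with precisely the facets that generate them. -/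
theorem isShelling_of_newPoints_eq {s : ℕ} {C : Fin s → RCone d}
    (hC : IsFacetOrdering S.cones C)
    (h : ∀ j, ∃ γ ∈ (C j).latticePoints,
      newPoints C j = (fun a => γ + a) '' (C j).latticePoints) : IsShelling S.cones C := by
  have hCS : ∀ i, C i ∈ S.cones := fun i => ((hC.2 _).1 ⟨i, rfl⟩).prop
  choose γ hγ hnew using h
  have hex : ∀ j, ∃ (t : ℕ) (D : Fin t → RCone d) (r : ℕ),
      IsShelling (RCone.boundaryFan (C j)) D ∧ r ≤ t ∧
      (⋃ l : Fin t, ⋃ _ : (l : ℕ) < r, (D l).fan) =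
        {F | F ∈ RCone.fan (C j) ∧ latticeVec (γ j) ∉ F} := fun j => by
    obtain ⟨u, hu⟩ := (S.rational _ (hCS j)).exists_finset
    have hz : latticeVec (γ j) ∈ PointedCone.hull ℝ (u : Set (Fin d → ℝ)) := hu ▸ hγ j
    rw [hu]
    exact exists_shelling_boundaryFan u hz
  choose t D r hsh hrt hD using hex
  refine IsShelling.step hC t D hsh fun j hj => ?_
  have hinter : (⋃ i : Fin s, ⋃ _ : i < j, (C i).fan ∩ (C j).fan) =
      ⋃ l : Fin (t j), ⋃ _ : (l : ℕ) < r j, (D j l).fan := by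
    rw [hD]
    ext F
    have hstar := Set.ext_iff.1 (latticeStar_eq_of_newPoints_eq hCS (hnew j)) F
    simp only [latticeStar, Set.mem_ofPred_eq, Set.mem_sdiff, Set.mem_iUnion, exists_prop,
      Set.mem_inter_iff] at hstar ⊢
    constructor
    · rintro ⟨i, hi, hFi, hFj⟩
      exact ⟨hFj, fun hmem => (hstar.1 ⟨hFj, hmem⟩).2 ⟨i, hi, hFi⟩⟩
    · rintro ⟨hFj, hmem⟩
      by_contra hcon
      exact hmem (hstar.2 ⟨hFj, fun ⟨i, hi, hFi⟩ => hcon ⟨i, hi, hFi, hFj⟩⟩).2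
  -- Two cones of a fan always meet in a common face. Nonemptiness of the union also forces the
  -- initial segment to have length at least one.
  have hne : (⋃ i : Fin s, ⋃ _ : i < j, (C i).fan ∩ (C j).fan).Nonempty :=
    ⟨C ⟨0, hj.trans j.2⟩ ⊓ C j, Set.mem_iUnion₂.2 ⟨⟨0, hj.trans j.2⟩, hj,
      S.inter_face _ (hCS _) _ (hCS _)⟩⟩
  refine ⟨hne, r j, ?_, hrt j, hinter⟩
  rw [hinter] at hne
  obtain ⟨F, hF⟩ := hne
  obtain ⟨k, hk, -⟩ := Set.mem_iUnion₂.1 hF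
  omega

end RationalPointedFan

/-! ### Clean filtrations of commutative rings -/

section CleanFiltration

variable {R : Type*} [CommRing R]

/-- The element `y` lifts the image of `1`: it generates `M` modulo `N`, with annihilator `P`. -/
theorem nonempty_quotient_equiv_iff {N M P : Ideal R} :
    Nonempty ((M ⧸ N.submoduleOf M) ≃ₗ[R] (R ⧸ P)) ↔
      ∃ y ∈ M, (∀ x ∈ M, ∃ g, x - g * y ∈ N) ∧ ∀ g, g * y ∈ N ↔ g ∈ P := by
  constructor
  · rintro ⟨e⟩
    obtain ⟨⟨y, hyM⟩, hy⟩ := Submodule.Quotient.mk_surjective _ (e.symm (Ideal.Quotient.mk P 1))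
    have hsmul : ∀ g : R, e.symm (Ideal.Quotient.mk P g) =
        Submodule.Quotient.mk ⟨g * y, M.mul_mem_left g hyM⟩ := by
      intro g
      have h1 : Ideal.Quotient.mk P g = g • Ideal.Quotient.mk P 1 := by
        rw [map_one, Algebra.smul_def, mul_one]
        rfl
      rw [h1, map_smul, ← hy, ← Submodule.Quotient.mk_smul]
      rfl
    refine ⟨y, hyM, fun x hx => ?_, fun g => ?_⟩
    · obtain ⟨g, hg⟩ := Ideal.Quotient.mk_surjective (e (Submodule.Quotient.mk ⟨x, hx⟩))
      refine ⟨g, ?_⟩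
      have h2 := hsmul g
      rw [hg, LinearEquiv.symm_apply_apply, Submodule.Quotient.eq] at h2
      exact h2
    · rw [← Ideal.Quotient.eq_zero_iff_mem (I := P), ← e.symm.map_eq_zero_iff, hsmul,
        Submodule.Quotient.mk_eq_zero]
      rfl
  · rintro ⟨y, hyM, hgen, hann⟩
    let f : R →ₗ[R] M ⧸ N.submoduleOf M :=
      (N.submoduleOf M).mkQ ∘ₗ LinearMap.toSpanSingleton R M ⟨y, hyM⟩
    have hf : Function.Surjective f := by
      intro x
      obtain ⟨⟨x, hx⟩, rfl⟩ := Submodule.Quotient.mk_surjective _ x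
      obtain ⟨g, hg⟩ := hgen x hx
      refine ⟨g, Eq.symm ((Submodule.Quotient.eq _).2 ?_)⟩
      exact hg
    have hker : LinearMap.ker f = P := by
      ext g
      rw [LinearMap.mem_ker, ← hann]
      exact Submodule.Quotient.mk_eq_zero _
    rw [← hker]
    exact ⟨(f.quotKerEquivOfSurjective hf).symm⟩

theorem isCleanRing_iff : IsCleanRing R ↔
    ∃ (r : ℕ) (N : Fin (r + 1) → Ideal R) (P : Fin r → PrimeSpectrum R),
      N 0 = ⊥ ∧ N (Fin.last r) = ⊤ ∧
      (∀ i : Fin r, N i.castSucc ≤ N i.succ ∧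
        ∃ y ∈ N i.succ, (∀ x ∈ N i.succ, ∃ g, x - g * y ∈ N i.castSucc) ∧
          ∀ g, g * y ∈ N i.castSucc ↔ g ∈ (P i).asIdeal) ∧
      Set.range P = {p | IsMin p} := by
  have hsupp : ∀ p : PrimeSpectrum R, p ∈ Module.support R R := fun p => by
    rw [Module.support_eq_zeroLocus, PrimeSpectrum.mem_zeroLocus]
    intro x hx
    have := Module.mem_annihilator.1 hx 1
    rw [smul_eq_mul, mul_one] at this
    rw [this]
    exact p.asIdeal.zero_mem
  have hmin : {p : PrimeSpectrum R | Minimal (· ∈ Module.support R R) p} = {p | IsMin p} := by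
    ext p
    exact ⟨fun h q hq => h.2 (hsupp q) hq, fun h => ⟨hsupp p, fun q _ hq => h hq⟩⟩
  simp only [IsCleanRing, IsCleanModule, hmin]
  refine exists_congr fun r => exists_congr fun N => exists_congr fun P => ?_
  refine and_congr_right fun _ => and_congr_right fun _ => and_congr_left fun _ => ?_
  refine forall_congr' fun i => and_congr_right fun _ => ?_
  exact nonempty_quotient_equiv_iff

section Filtration

variable {r : ℕ} {N : Fin (r + 1) → Ideal R} {P : Fin r → Ideal R} {y : Fin r → R}

/-- By `hred`, localizing at `P i` gives a field, which leaves room for one factor only. Concretely,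
if `P i = P j` with `i < j`, then `y i ∈ P j`, so an `s ∉ P j` kills `y i`, and `s ∈ P i`. -/
theorem filtration_primes_injective [∀ i, (P i).IsPrime] (hN : Monotone N)
    (hy : ∀ i, y i ∈ N i.succ) (hann : ∀ i g, g * y i ∈ N i.castSucc ↔ g ∈ P i)
    (hred : ∀ i, ∃ s ∉ P i, ∀ x ∈ P i, s * x = 0) : Function.Injective P := by
  have key : ∀ i j, i < j → P i ≠ P j := by
    intro i j hij heq
    have hyj : y i ∈ P j := (hann j _).1 (Ideal.mul_mem_right _ _
      (hN (Fin.succ_le_castSucc_iff.2 hij) (hy i)))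
    obtain ⟨s, hs, hs0⟩ := hred j
    refine hs (heq ▸ (hann i s).1 ?_)
    rw [hs0 _ hyj]
    exact Ideal.zero_mem _
  intro i j hij
  rcases lt_trichotomy i j with h | h | h
  · exact absurd hij (key i j h)
  · exact h
  · exact absurd hij.symm (key j i h)

/-- For `≤`, climb from the bottom: some `g ∈ P i` outside `P k` sends `N i.succ` into `N
i.castSucc`, which lies in `P k`. For `≥`, descend from the top: write `x ∈ P i` as `g * y i` modulo
`N i.castSucc`; an `s ∉ P i` kills `x`, which forces `g ∈ P i`. -/
theorem filtration_eq_iInf [∀ i, (P i).IsPrime] (h0 : N 0 = ⊥) (hlast : N (Fin.last r) = ⊤)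
    (hN : Monotone N) (hy : ∀ i, y i ∈ N i.succ)
    (hgen : ∀ i, ∀ x ∈ N i.succ, ∃ g, x - g * y i ∈ N i.castSucc)
    (hann : ∀ i g, g * y i ∈ N i.castSucc ↔ g ∈ P i)
    (hred : ∀ i, ∃ s ∉ P i, ∀ x ∈ P i, s * x = 0)
    (hinc : ∀ i j, P i ≤ P j → P i = P j) (i : Fin (r + 1)) :
    N i = ⨅ k : Fin r, ⨅ _ : i ≤ k.castSucc, P k := by
  have hinj := filtration_primes_injective hN hy hann hred
  apply le_antisymm
  · refine le_iInf₂ fun k hk => ?_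
    induction i using Fin.induction with
    | zero => rw [h0]; exact bot_le
    | succ i ih =>
      have hik : i < k := Fin.succ_le_castSucc_iff.1 hk
      have ih := ih (Fin.castSucc_le_castSucc_iff.2 hik.le)
      obtain ⟨g, hg, hgk⟩ := SetLike.not_le_iff_exists.1
        fun h => hik.ne (hinj (hinc i k h))
      intro x hx
      obtain ⟨c, hc⟩ := hgen i x hx
      have h1 : g * (x - c * y i) + c * (g * y i) ∈ P k :=
        Ideal.add_mem _ (Ideal.mul_mem_left _ _ (ih hc))
          (Ideal.mul_mem_left _ _ (ih ((hann i g).2 hg)))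
      have h2 : g * (x - c * y i) + c * (g * y i) = g * x := by ring
      rw [h2] at h1
      exact (Ideal.IsPrime.mem_or_mem inferInstance h1).resolve_left hgk
  · induction i using Fin.reverseInduction with
    | last => rw [hlast]; exact le_top
    | cast i ih =>
      intro x hx
      simp only [Submodule.mem_iInf] at hx
      have hxi : x ∈ N i.succ := ih (by
        simp only [Submodule.mem_iInf]
        exact fun k hk => hx k ((Fin.castSucc_lt_succ).le.trans hk))
      obtain ⟨g, hg⟩ := hgen i x hxi
      obtain ⟨s, hs, hs0⟩ := hred i
      have hsg : s * g * y i ∈ N i.castSucc := by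
        have h1 : s * g * y i = s * x - s * (x - g * y i) := by ring
        rw [h1, hs0 x (hx i le_rfl), zero_sub]
        exact (N i.castSucc).neg_mem (Ideal.mul_mem_left _ _ hg)
      have hgP : g ∈ P i :=
        (Ideal.IsPrime.mem_or_mem inferInstance ((hann i _).1 hsg)).resolve_left hs
      have h2 := Ideal.add_mem _ hg ((hann i g).2 hgP)
      rwa [sub_add_cancel] at h2

end Filtration

end CleanFiltration

/-! ### Monomial calculus and minimal primes of the toric face ring -/

namespace ToricFaceRing

variable {d : ℕ} {K : Type*} [Field K] {S : RationalPointedFan d}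

/-- The coefficient of the monomial `x^a`. -/
noncomputable def coeff (a : S.latticePoints) : ToricFaceRing K S →ₗ[K] K :=
  (Finsupp.lapply a : (S.latticePoints →₀ K) →ₗ[K] K)

theorem coeff_ext {f g : ToricFaceRing K S} (h : ∀ a, coeff a f = coeff a g) : f = g :=
  Finsupp.ext h

open Classical in
theorem coeff_monomial (a b : S.latticePoints) :
    coeff a (monomial b : ToricFaceRing K S) = if b = a then 1 else 0 :=
  Finsupp.single_apply

/-- The exponents of the monomials that occur in `f`. -/
noncomputable def support (f : ToricFaceRing K S) : Finset S.latticePoints :=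
  Finsupp.support (show S.latticePoints →₀ K from f)

theorem mem_support {f : ToricFaceRing K S} {a : S.latticePoints} :
    a ∈ support f ↔ coeff a f ≠ 0 := Finsupp.mem_support_iff

theorem eq_sum_monomial (f : ToricFaceRing K S) :
    f = ∑ a ∈ support f, coeff a f • monomial a := by
  classical
  refine coeff_ext fun b => ?_
  simp only [map_sum, map_smul, coeff_monomial, smul_eq_mul, mul_ite, mul_one, mul_zero,
    Finset.sum_ite_eq', mem_support]
  split_ifs with h
  · rfl
  · exact not_not.1 h

theorem smul_mul_smul' (a b : K) (f g : ToricFaceRing K S) :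
    (a • f) * (b • g) = (a * b) • (f * g) := by
  simp [mul_def, smul_smul, mul_comm]

open Classical in
theorem coeff_mul (f g : ToricFaceRing K S) (a : S.latticePoints) :
    coeff a (f * g) = ∑ b ∈ support f, ∑ c ∈ support g,
      if S.InCommonCone b c ∧ (b : Fin d → ℤ) + c = a then coeff b f * coeff c g else 0 := by
  conv_lhs => rw [eq_sum_monomial f, eq_sum_monomial g]
  rw [Finset.sum_mul_sum, map_sum]
  refine Finset.sum_congr rfl fun b _ => ?_
  rw [map_sum]
  refine Finset.sum_congr rfl fun c _ => ?_
  rw [smul_mul_smul', map_smul, monomial_mul_monomial, smul_eq_mul]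
  by_cases h : S.InCommonCone b c
  · rw [dif_pos h, coeff_monomial]
    by_cases h' : (b : Fin d → ℤ) + c = a
    · rw [if_pos (Subtype.ext h'), if_pos ⟨h, h'⟩, mul_one]
    · rw [if_neg fun h'' => h' (Subtype.ext_iff.1 h''), if_neg fun h'' => h' h''.2, mul_zero]
  · rw [dif_neg h, map_zero, mul_zero, if_neg fun h' => h h'.1]

theorem exists_mem_support_of_coeff_mul_ne_zero {f g : ToricFaceRing K S} {a : S.latticePoints}
    (h : coeff a (f * g) ≠ 0) : ∃ b ∈ support f, ∃ c ∈ support g,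
      S.InCommonCone b c ∧ (b : Fin d → ℤ) + c = a := by
  classical
  rw [coeff_mul] at h
  obtain ⟨b, hb, h⟩ := Finset.exists_ne_zero_of_sum_ne_zero h
  obtain ⟨c, hc, h⟩ := Finset.exists_ne_zero_of_sum_ne_zero h
  exact ⟨b, hb, c, hc, (ite_ne_right_iff.1 h).1⟩

theorem coeff_mul_of_unique {f g : ToricFaceRing K S} {a z : S.latticePoints}
    (hz : (z : Fin d → ℤ) = 0)
    (h : ∀ b ∈ support f, ∀ c ∈ support g, S.InCommonCone b c → (b : Fin d → ℤ) + c = a →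
      c = a) : coeff a (f * g) = coeff z f * coeff a g := by
  classical
  have hza : S.InCommonCone z a := by
    obtain ⟨C, hC, ha⟩ := a.2
    refine ⟨C, hC, ?_, ha⟩
    change latticeVec z.1 ∈ C
    rw [hz, RationalPointedFan.latticeVec_zero]
    exact Submodule.zero_mem C
  rw [coeff_mul, Finset.sum_eq_single z, Finset.sum_eq_single a]
  · rw [if_pos ⟨hza, by rw [hz, zero_add]⟩]
  · intro c hc hca
    refine if_neg fun h' => hca (Subtype.ext ?_)
    rw [← h'.2, hz, zero_add]
  · intro ha
    rw [mem_support, not_not] at ha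
    rw [ha, mul_zero, ite_self]
  · intro b hb hbz
    refine Finset.sum_eq_zero fun c hc => if_neg fun h' => hbz (Subtype.ext ?_)
    have := h'.2
    rw [h b hb c hc h'.1 h'.2] at this
    rw [hz]
    exact add_eq_right.1 this
  · intro hzf
    rw [mem_support, not_not] at hzf
    refine Finset.sum_eq_zero fun c _ => ?_
    rw [hzf, zero_mul, ite_self]

/-- Two cones meet in a face, so the monomials outside `C` span an ideal; this makes `restrict`
multiplicative. -/
theorem mem_of_add_mem {C : RCone d} (hC : C ∈ S.cones) {b c : Fin d → ℤ}
    (h : S.InCommonCone b c) (hbc : b + c ∈ C.latticePoints) :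
    b ∈ C.latticePoints ∧ c ∈ C.latticePoints := by
  obtain ⟨D, hD, hb, hc⟩ := h
  change latticeVec (b + c) ∈ C at hbc
  rw [RationalPointedFan.latticeVec_add] at hbc
  have hF := (S.inter_face D hD C hC).1
  have hmem : latticeVec b + latticeVec c ∈ D ⊓ C := ⟨Submodule.add_mem D hb hc, hbc⟩
  exact ⟨(hF.mem_of_add_mem_left hb hc hmem).2, (hF.mem_of_add_mem_right hb hc hmem).2⟩

variable (K) in
open Classical in
/-- The map that sends a monomial `x^a` to itself if `a ∈ C` and to `0` otherwise. -/
noncomputable def restrict (C : RCone d) :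
    ToricFaceRing K S →ₗ[K] AddMonoidAlgebra K (Fin d → ℤ) :=
  extend fun a => if (a : Fin d → ℤ) ∈ C.latticePoints then AddMonoidAlgebra.single a.1 1 else 0

open Classical in
theorem restrict_monomial (C : RCone d) (a : S.latticePoints) :
    restrict K C (monomial a) =
      if (a : Fin d → ℤ) ∈ C.latticePoints then AddMonoidAlgebra.single a.1 1 else 0 :=
  extend_monomial _ _

theorem restrict_mul {C : RCone d} (hC : C ∈ S.cones) (f g : ToricFaceRing K S) :
    restrict K C (f * g) = restrict K C f * restrict K C g := by
  classical
  have key : ∀ a b : S.latticePoints, restrict K C (monomial a * monomial b) =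
      restrict K C (monomial a) * restrict K C (monomial b) := by
    intro a b
    rw [monomial_mul_monomial, restrict_monomial, restrict_monomial]
    by_cases hab : (a : Fin d → ℤ) ∈ C.latticePoints ∧ (b : Fin d → ℤ) ∈ C.latticePoints
    · have h : S.InCommonCone a b := ⟨C, hC, hab⟩
      have hsum : (a : Fin d → ℤ) + b ∈ C.latticePoints := by
        change latticeVec _ ∈ C
        rw [RationalPointedFan.latticeVec_add]
        exact Submodule.add_mem C hab.1 hab.2
      rw [dif_pos h, restrict_monomial, if_pos hsum, if_pos hab.1, if_pos hab.2,
        AddMonoidAlgebra.single_mul_single, mul_one]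
    · have hr : ((if (a : Fin d → ℤ) ∈ C.latticePoints then AddMonoidAlgebra.single a.1 1 else 0) *
          (if (b : Fin d → ℤ) ∈ C.latticePoints then AddMonoidAlgebra.single b.1 1 else 0) :
          AddMonoidAlgebra K (Fin d → ℤ)) = 0 := by
        by_cases ha : (a : Fin d → ℤ) ∈ C.latticePoints
        · rw [if_neg fun hb => hab ⟨ha, hb⟩, mul_zero]
        · rw [if_neg ha, zero_mul]
      rw [hr]
      by_cases h : S.InCommonCone a b
      · rw [dif_pos h, restrict_monomial, if_neg fun hm => hab (mem_of_add_mem hC h hm)]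
      · rw [dif_neg h, map_zero]
  rw [eq_sum_monomial f, eq_sum_monomial g, Finset.sum_mul_sum, map_sum, map_sum, map_sum,
    Finset.sum_mul_sum]
  refine Finset.sum_congr rfl fun a _ => ?_
  rw [map_sum]
  refine Finset.sum_congr rfl fun b _ => ?_
  rw [smul_mul_smul', map_smul, map_smul, map_smul, key, smul_mul_smul_comm]

theorem zero_mem_latticePoints (C : RCone d) : (0 : Fin d → ℤ) ∈ C.latticePoints := by
  change latticeVec 0 ∈ C
  rw [RationalPointedFan.latticeVec_zero]
  exact Submodule.zero_mem C

theorem one_eq_monomial (h : (0 : Fin d → ℤ) ∈ S.latticePoints) :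
    (1 : ToricFaceRing K S) = monomial ⟨0, h⟩ := dif_pos h

variable (K) in
/-- The projection of the toric face ring to the monoid algebra of a cone, inside the algebra of
Laurent polynomials. -/
noncomputable def restrictHom {C : RCone d} (hC : C ∈ S.cones) :
    ToricFaceRing K S →+* AddMonoidAlgebra K (Fin d → ℤ) where
  toFun := restrict K C
  map_one' := by
    rw [one_eq_monomial ⟨C, hC, zero_mem_latticePoints C⟩, restrict_monomial,
      if_pos (zero_mem_latticePoints C)]
    rfl
  map_mul' := restrict_mul hC
  map_zero' := map_zero _
  map_add' := map_add _

variable (K) in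
/-- The prime ideal generated by the monomials `x^a` with `a ∉ C`. -/
noncomputable def facePrime {C : RCone d} (hC : C ∈ S.cones) : Ideal (ToricFaceRing K S) :=
  RingHom.ker (restrictHom K hC)

instance facePrime_isPrime {C : RCone d} (hC : C ∈ S.cones) : (facePrime K hC).IsPrime :=
  RingHom.ker_isPrime _

theorem coeff_restrict (C : RCone d) (f : ToricFaceRing K S) (a : S.latticePoints)
    (ha : (a : Fin d → ℤ) ∈ C.latticePoints) : (restrict K C f).coeff a = coeff a f := by
  classical
  rw [eq_sum_monomial f]
  simp only [map_sum, map_smul, coeff_monomial, restrict_monomial, AddMonoidAlgebra.coeff_sum,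
    Finsupp.coe_finsetSum, Finset.sum_apply, AddMonoidAlgebra.coeff_smul, Finsupp.smul_apply]
  refine Finset.sum_congr rfl fun b _ => ?_
  by_cases hba : b = a
  · subst hba
    rw [if_pos ha, if_pos rfl, AddMonoidAlgebra.coeff_single, Finsupp.single_eq_same]
  · rw [if_neg hba]
    split_ifs with hb
    · rw [AddMonoidAlgebra.coeff_single, Finsupp.single_eq_of_ne]
      exact fun h => hba (Subtype.ext h.symm)
    · simp

theorem mem_facePrime {C : RCone d} {hC : C ∈ S.cones} {f : ToricFaceRing K S} :
    f ∈ facePrime K hC ↔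
      ∀ a : S.latticePoints, (a : Fin d → ℤ) ∈ C.latticePoints → coeff a f = 0 := by
  classical
  rw [facePrime, RingHom.mem_ker]
  change restrict K C f = 0 ↔ _
  constructor
  · intro h a ha
    rw [← coeff_restrict C f a ha, h]
    rfl
  · intro h
    rw [eq_sum_monomial f, map_sum]
    refine Finset.sum_eq_zero fun a _ => ?_
    rw [map_smul, restrict_monomial]
    split_ifs with ha
    · rw [h a ha, zero_smul]
    · rw [smul_zero]

theorem monomial_mem_facePrime {C : RCone d} {hC : C ∈ S.cones} {a : S.latticePoints} :
    (monomial a : ToricFaceRing K S) ∈ facePrime K hC ↔ (a : Fin d → ℤ) ∉ C.latticePoints := by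
  classical
  simp only [mem_facePrime, coeff_monomial]
  refine ⟨fun h ha => ?_, fun h b hb => if_neg ?_⟩
  · have := h a ha
    rw [if_pos rfl] at this
    exact one_ne_zero this
  · rintro rfl
    exact h hb

theorem facePrime_le_iff {C D : RCone d} (hC : C ∈ S.cones) (hD : D ∈ S.cones) :
    facePrime K hC ≤ facePrime K hD ↔ D ≤ C := by
  refine ⟨fun h => S.le_of_latticePoints_subset hC hD fun a ha => ?_, fun h f hf => ?_⟩
  · by_contra haC
    exact monomial_mem_facePrime.1
      (h (monomial_mem_facePrime (a := ⟨a, D, hD, ha⟩) |>.2 haC)) ha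
  · rw [mem_facePrime] at hf ⊢
    exact fun a ha => hf a (h ha)

theorem facePrime_eq_iff {C D : RCone d} (hC : C ∈ S.cones) (hD : D ∈ S.cones) :
    facePrime K hC = facePrime K hD ↔ C = D := by
  refine ⟨fun h => ?_, fun h => by subst h; rfl⟩
  exact le_antisymm ((facePrime_le_iff hD hC).1 h.ge) ((facePrime_le_iff hC hD).1 h.le)

/-- Every exponent lies in some facet, whose prime detects its coefficient. -/
theorem eq_zero_of_forall_mem_facePrime {f : ToricFaceRing K S}
    (h : ∀ (C : RCone d) (hC : Maximal (· ∈ S.cones) C), f ∈ facePrime K hC.prop) : f = 0 := by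
  refine coeff_ext fun a => ?_
  obtain ⟨C, hC, ha⟩ := a.2
  obtain ⟨D, hD, hCD⟩ := S.exists_maximal_le hC
  rw [map_zero]
  exact mem_facePrime.1 (h D hD) a (hCD ha)

theorem exists_facePrime_le (p : Ideal (ToricFaceRing K S)) [p.IsPrime] :
    ∃ (C : RCone d) (hC : Maximal (· ∈ S.cones) C), facePrime K hC.prop ≤ p := by
  classical
  have hfin : Finite {C : RCone d // Maximal (· ∈ S.cones) C} :=
    Set.Finite.to_subtype (S.finite.subset fun C hC => hC.1)
  have := Fintype.ofFinite {C : RCone d // Maximal (· ∈ S.cones) C}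
  obtain ⟨⟨C, hC⟩, -, h⟩ := (Ideal.IsPrime.inf_le' (s := Finset.univ)
    (f := fun C : {C : RCone d // Maximal (· ∈ S.cones) C} => facePrime K C.2.prop)
    (inferInstance : p.IsPrime)).1 fun f hf => by
      have : f = 0 := eq_zero_of_forall_mem_facePrime fun C hC =>
        (Submodule.mem_finsetInf.1 hf) ⟨C, hC⟩ (Finset.mem_univ _)
      rw [this]
      exact p.zero_mem
  exact ⟨C, hC, h⟩

theorem isMin_iff (p : PrimeSpectrum (ToricFaceRing K S)) :
    IsMin p ↔ ∃ (C : RCone d) (hC : Maximal (· ∈ S.cones) C), p.asIdeal = facePrime K hC.prop := by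
  constructor
  · intro h
    obtain ⟨C, hC, hle⟩ := exists_facePrime_le p.asIdeal
    exact ⟨C, hC, le_antisymm (h (b := ⟨facePrime K hC.prop, inferInstance⟩) hle) hle⟩
  · rintro ⟨C, hC, h⟩ q hq
    obtain ⟨D, hD, hle⟩ := exists_facePrime_le q.asIdeal
    have hDC : facePrime K hD.prop ≤ facePrime K hC.prop := h ▸ hle.trans hq
    have heq : C = D := hC.eq_of_le hD.prop ((facePrime_le_iff _ _).1 hDC)
    subst heq
    change p.asIdeal ≤ q.asIdeal
    rw [h]
    exact hle

/-- Localizing at a minimal prime yields a field: some element outside the prime kills it. -/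
theorem exists_notMem_forall_mul_eq_zero {C : RCone d} (hC : Maximal (· ∈ S.cones) C) :
    ∃ s ∉ facePrime K hC.prop, ∀ x ∈ facePrime K hC.prop, s * x = 0 := by
  obtain ⟨a, ha, hgen⟩ := (S.rational C hC.prop).exists_latticePoint
  -- The exponent `a` lies in no proper face of `C`, hence in no other facet. So the monomial
  -- belongs to every other facet prime, and its product with `x` to all of them.
  refine ⟨monomial ⟨a, C, hC.prop, ha⟩, fun h => monomial_mem_facePrime.1 h ha, fun x hx => ?_⟩
  refine eq_zero_of_forall_mem_facePrime fun D hD => ?_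
  by_cases haD : a ∈ D.latticePoints
  · have hCD : C ≤ D := (hgen _ (S.inter_face C hC.prop D hD.prop).1 ⟨ha, haD⟩).trans inf_le_right
    have heq : C = D := hC.eq_of_le hD.prop hCD
    subst heq
    exact Ideal.mul_mem_left _ _ hx
  · exact Ideal.mul_mem_right _ _ (monomial_mem_facePrime.2 haD)

end ToricFaceRing

/-! ### Clean filtrations and translates of the monoids of facets -/

namespace ToricFaceRing

open RationalPointedFan

variable {d : ℕ} {K : Type*} [Field K] {S : RationalPointedFan d}

theorem smul_mem_ideal (I : Ideal (ToricFaceRing K S)) (c : K) {f : ToricFaceRing K S}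
    (hf : f ∈ I) : c • f ∈ I := by
  have h : c • f = (c • (1 : ToricFaceRing K S)) * ((1 : K) • f) := by
    rw [smul_mul_smul', mul_one, one_mul]
  rw [h, one_smul]
  exact I.mul_mem_left _ hf

theorem add_mem_latticePoints {C : RCone d} {a b : Fin d → ℤ} (ha : a ∈ C.latticePoints)
    (hb : b ∈ C.latticePoints) : a + b ∈ C.latticePoints := by
  change latticeVec _ ∈ C
  rw [latticeVec_add]
  exact Submodule.add_mem C ha hb

/-- If a set `T` of lattice points of a pointed cone is generated by a finite subset `B`, then every
element of `T` lies above a minimal one. -/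
theorem exists_minimal_generator {C : RCone d} (hC : C ∈ S.cones) {T B : Set (Fin d → ℤ)}
    (hB : B.Finite) (hBT : B ⊆ T)
    (hgen : ∀ t ∈ T, ∃ b ∈ B, ∃ m ∈ C.latticePoints, b + m = t) {t : Fin d → ℤ} (ht : t ∈ T) :
    ∃ b ∈ T, (∃ m ∈ C.latticePoints, b + m = t) ∧
      ∀ t' ∈ T, ∀ m ∈ C.latticePoints, t' + m = b → t' = b := by
  let A : Set (Fin d → ℤ) := {b | b ∈ B ∧ ∃ m ∈ C.latticePoints, b + m = t}
  have hA : Finite A := (hB.subset fun b hb => hb.1).to_subtype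
  -- Strict divisibility, on the finitely many generators below `t`. Pointedness keeps it strict
  -- under composition.
  let rel : A → A → Prop := fun b c => ∃ m ∈ C.latticePoints, m ≠ 0 ∧ (b : Fin d → ℤ) + m = c
  have htrans : IsTrans A rel := ⟨by
    rintro a b c ⟨m, hm, -, h⟩ ⟨m', hm', hm0, h'⟩
    exact ⟨m + m', add_mem_latticePoints hm hm',
      fun h0 => hm0 (eq_zero_of_mem_of_neg_mem hC hm hm' h0),
      by rw [← h', ← h, add_assoc]⟩⟩
  have hirr : Std.Irrefl rel := ⟨by
    rintro a ⟨m, -, hm0, h⟩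
    exact hm0 (add_eq_left.1 h)⟩
  obtain ⟨b₀, hb₀, m₀, hm₀, h₀⟩ := hgen t ht
  obtain ⟨⟨b, hbB, m₁, hm₁, h₁⟩, -, hmin⟩ :=
    (Finite.wellFounded_of_trans_of_irrefl rel).has_min Set.univ ⟨⟨b₀, hb₀, m₀, hm₀, h₀⟩, trivial⟩
  refine ⟨b, hBT hbB, ⟨m₁, hm₁, h₁⟩, fun t' ht' m hm h => ?_⟩
  obtain ⟨c, hc, m', hm', h'⟩ := hgen t' ht'
  have hcb : c + (m' + m) = b := by rw [← add_assoc, h', h]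
  have hmm := add_mem_latticePoints hm' hm
  have h0 : m' + m = 0 := by
    by_contra hne
    exact hmin ⟨c, hc, m' + m + m₁, add_mem_latticePoints hmm hm₁,
      by rw [← add_assoc, hcb, h₁]⟩ trivial ⟨m' + m, hmm, hne, hcb⟩
  rw [eq_zero_of_mem_of_neg_mem hC hm' hm h0, add_zero] at h
  exact h

/-- A set of lattice points that spans a principal monomial module is a translate of the
monoid. -/
theorem exists_translate_of_cyclic {C : RCone d} (hC : C ∈ S.cones) {T : Set (Fin d → ℤ)}
    (hTC : T ⊆ C.latticePoints) (hne : T.Nonempty)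
    (hadd : ∀ t ∈ T, ∀ m ∈ C.latticePoints, t + m ∈ T) (y : ToricFaceRing K S)
    (hy : ∀ b ∈ support y, (b : Fin d → ℤ) ∈ C.latticePoints → (b : Fin d → ℤ) ∈ T)
    (hgen : ∀ a : S.latticePoints, (a : Fin d → ℤ) ∈ T → ∃ g : ToricFaceRing K S,
      ∀ b : S.latticePoints, (b : Fin d → ℤ) ∈ T → coeff b (monomial a - g * y) = 0) :
    ∃ γ ∈ C.latticePoints, T = (fun a => γ + a) '' C.latticePoints := by
  classical
  have hlift : ∀ t ∈ T, t ∈ S.latticePoints := fun t ht => ⟨C, hC, hTC ht⟩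
  have hcoeff : ∀ a : S.latticePoints, (a : Fin d → ℤ) ∈ T → ∃ g : ToricFaceRing K S,
      ∀ b : S.latticePoints, (b : Fin d → ℤ) ∈ T →
        coeff b (g * y) = if a = b then 1 else 0 := by
    intro a ha
    obtain ⟨g, hg⟩ := hgen a ha
    refine ⟨g, fun b hb => ?_⟩
    have := hg b hb
    rw [map_sub, coeff_monomial, sub_eq_zero] at this
    exact this.symm
  have hmin : ∀ t ∈ T, ∃ b ∈ T, (∃ m ∈ C.latticePoints, b + m = t) ∧
      ∀ t' ∈ T, ∀ m ∈ C.latticePoints, t' + m = b → t' = b := by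
    intro t ht
    refine exists_minimal_generator hC (B := T ∩ (Subtype.val '' (support y : Set S.latticePoints)))
      (((support y).finite_toSet.image _).inter_of_right _) Set.inter_subset_left ?_ ht
    intro t ht
    obtain ⟨g, hg⟩ := hcoeff ⟨t, hlift t ht⟩ ht
    have h1 : coeff ⟨t, hlift t ht⟩ (g * y) ≠ 0 := by
      rw [hg _ ht, if_pos rfl]
      exact one_ne_zero
    obtain ⟨b, -, c, hc, hbc, h⟩ := exists_mem_support_of_coeff_mul_ne_zero h1
    have hmem := mem_of_add_mem hC hbc (by rw [h]; exact hTC ht)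
    exact ⟨c, ⟨hy c hc hmem.2, c, hc, rfl⟩, b, hmem.1, by rw [add_comm]; exact h⟩
  -- At a minimal exponent only the constant term of `g` contributes to the product with `y`.
  have hmul : ∀ (b : S.latticePoints), (b : Fin d → ℤ) ∈ T →
      (∀ t' ∈ T, ∀ m ∈ C.latticePoints, t' + m = b → t' = b) → ∀ g : ToricFaceRing K S,
      coeff b (g * y) = coeff ⟨0, C, hC, zero_mem_latticePoints C⟩ g * coeff b y := by
    intro b hb hbmin g
    refine coeff_mul_of_unique rfl fun c hc e he hce h => Subtype.ext ?_
    have hmem := mem_of_add_mem hC hce (by rw [h]; exact hTC hb)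
    exact hbmin e (hy e he hmem.2) c hmem.1 (by rw [add_comm]; exact h)
  obtain ⟨t₀, ht₀⟩ := hne
  obtain ⟨γ, hγ, -, hγmin⟩ := hmin t₀ ht₀
  -- At distinct minimal `b` and `γ` the coefficients of `y` are both nonzero, since each monomial
  -- is a multiple of `y` on `T`. A `g` producing `x^γ` has nonzero constant term, so `g * y` would
  -- also have a term at `b`.
  have huniq : ∀ b ∈ T, (∀ t' ∈ T, ∀ m ∈ C.latticePoints, t' + m = b → t' = b) → b = γ := by
    intro b hb hbmin
    by_contra hbγ
    obtain ⟨g, hg⟩ := hcoeff ⟨γ, hlift γ hγ⟩ hγ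
    obtain ⟨g', hg'⟩ := hcoeff ⟨b, hlift b hb⟩ hb
    have h1 := hg ⟨γ, hlift γ hγ⟩ hγ
    have h2 := hg ⟨b, hlift b hb⟩ hb
    have h3 := hg' ⟨b, hlift b hb⟩ hb
    rw [if_pos rfl, hmul ⟨γ, hlift γ hγ⟩ hγ hγmin] at h1
    rw [if_neg fun h => hbγ (Subtype.ext_iff.1 h).symm, hmul ⟨b, hlift b hb⟩ hb hbmin] at h2
    rw [if_pos rfl, hmul ⟨b, hlift b hb⟩ hb hbmin] at h3
    rcases mul_eq_zero.1 h2 with h | h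
    · rw [h, zero_mul] at h1
      exact zero_ne_one h1
    · rw [h, mul_zero] at h3
      exact zero_ne_one h3
  refine ⟨γ, hTC hγ, Set.Subset.antisymm (fun t ht => ?_) ?_⟩
  · obtain ⟨b, hb, ⟨m, hm, h⟩, hbmin⟩ := hmin t ht
    rw [huniq b hb hbmin] at h
    exact ⟨m, hm, h⟩
  · rintro _ ⟨m, hm, rfl⟩
    exact hadd γ hγ m hm

theorem exists_newPoints_eq_of_isCleanRing (h : IsCleanRing (ToricFaceRing K S)) :
    ∃ (s : ℕ) (C : Fin s → RCone d), IsFacetOrdering S.cones C ∧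
      ∀ j, ∃ γ ∈ (C j).latticePoints,
        newPoints C j = (fun a => γ + a) '' (C j).latticePoints := by
  obtain ⟨r, N, P, h0, hlast, hfilt, hrange⟩ := isCleanRing_iff.1 h
  have hPmin : ∀ i, IsMin (P i) := fun i => (Set.ext_iff.1 hrange (P i)).1 ⟨i, rfl⟩
  choose F hFmax hPF using fun i => (isMin_iff (P i)).1 (hPmin i)
  choose hle y hy hgen hann using hfilt
  have hmono : Monotone N := Fin.monotone_iff_le_succ.2 hle
  have hred : ∀ i, ∃ s ∉ (P i).asIdeal, ∀ x ∈ (P i).asIdeal, s * x = 0 := fun i => by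
    rw [hPF i]
    exact exists_notMem_forall_mul_eq_zero (hFmax i)
  have hinj : Function.Injective F := by
    intro i k hik
    refine filtration_primes_injective hmono hy hann hred ?_
    change (P i).asIdeal = (P k).asIdeal
    rw [hPF i, hPF k, facePrime_eq_iff]
    exact hik
  have hN := filtration_eq_iInf h0 hlast hmono hy hgen hann hred fun i k hik =>
    le_antisymm hik (hPmin k hik)
  have hmemN : ∀ (i : Fin (r + 1)) (f : ToricFaceRing K S), f ∈ N i ↔
      ∀ k : Fin r, i ≤ k.castSucc → f ∈ facePrime K (hFmax k).prop := by
    intro i f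
    rw [hN]
    simp only [Submodule.mem_iInf, hPF]
  -- The order is reversed: `N i` is cut out by the primes from index `i` on, so the exponents new
  -- at step `i` avoid the facets with larger index.
  refine ⟨r, fun j => F j.rev, ⟨hinj.comp Fin.rev_injective, fun D => ⟨?_, fun hD => ?_⟩⟩,
    fun j => ?_⟩
  · rintro ⟨j, rfl⟩
    exact hFmax _
  · have hmin : IsMin (⟨facePrime K hD.prop, inferInstance⟩ :
        PrimeSpectrum (ToricFaceRing K S)) := (isMin_iff _).2 ⟨D, hD, rfl⟩
    obtain ⟨i, hi⟩ := (Set.ext_iff.1 hrange _).2 hmin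
    refine ⟨i.rev, ?_⟩
    have h1 : (P i).asIdeal = facePrime K hD.prop := congrArg PrimeSpectrum.asIdeal hi
    rw [hPF i, facePrime_eq_iff] at h1
    simpa using h1
  · have hnew : ∀ a : Fin d → ℤ, a ∈ newPoints (fun j => F j.rev) j ↔
        a ∈ (F j.rev).latticePoints ∧ ∀ k, j.rev < k → a ∉ (F k).latticePoints := by
      intro a
      refine and_congr_right fun _ => ⟨fun h k hk => ?_, fun h i hi => h _ (Fin.rev_lt_rev.2 hi)⟩
      have := h k.rev (Fin.rev_lt_iff.1 hk)
      simpa using this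
    change ∃ γ ∈ (F j.rev).latticePoints, newPoints (fun j => F j.rev) j =
      (fun a => γ + a) '' (F j.rev).latticePoints
    generalize j.rev = i at hnew ⊢
    have hFi := (hFmax i).prop
    have hysucc := (hmemN _ _).1 (hy i)
    have hyT : ∀ b ∈ support (y i), (b : Fin d → ℤ) ∈ (F i).latticePoints →
        (b : Fin d → ℤ) ∈ newPoints (fun j => F j.rev) j := by
      intro b hb hbF
      refine (hnew b).2 ⟨hbF, fun k hk hbk => mem_support.1 hb ?_⟩
      exact mem_facePrime.1 (hysucc k (Fin.succ_le_castSucc_iff.2 hk)) b hbk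
    refine exists_translate_of_cyclic hFi (fun a ha => ((hnew a).1 ha).1) ?_ ?_ (y i) hyT ?_
    -- Otherwise `y i` would already lie in `N i.castSucc`, and its annihilator `P i` would contain
    -- `1`.
    · have hynot : y i ∉ facePrime K hFi := by
        intro hmem
        refine (P i).isPrime.one_notMem ((hann i 1).1 ?_)
        rw [one_mul, hmemN]
        intro k hk
        rcases (Fin.castSucc_le_castSucc_iff.1 hk).eq_or_lt with rfl | hlt
        · exact hmem
        · exact hysucc k (Fin.succ_le_castSucc_iff.2 hlt)
      rw [mem_facePrime] at hynot
      push Not at hynot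
      obtain ⟨a, ha, hne⟩ := hynot
      exact ⟨a, hyT a (mem_support.2 hne) ha⟩
    · intro t ht m hm
      rw [hnew] at ht ⊢
      refine ⟨add_mem_latticePoints ht.1 hm, fun k hk hmem => ht.2 k hk ?_⟩
      exact (mem_of_add_mem (hFmax k).prop ⟨F i, hFi, ht.1, hm⟩ hmem).1
    · intro a ha
      have hmon : (monomial a : ToricFaceRing K S) ∈ N i.succ := (hmemN _ _).2 fun k hk =>
        monomial_mem_facePrime.2 (((hnew a).1 ha).2 k (Fin.succ_le_castSucc_iff.1 hk))
      obtain ⟨g, hg⟩ := hgen i _ hmon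
      refine ⟨g, fun b hb => ?_⟩
      exact mem_facePrime.1 ((hmemN _ _).1 hg i le_rfl) b ((hnew b).1 hb).1

/-- Intersecting the facet primes from an index on, in reversed order, gives the filtration; the
monomial `x^γ` generates each quotient because the new exponents are the translate by `γ`. -/
theorem isCleanRing_of_newPoints_eq {s : ℕ} {C : Fin s → RCone d}
    (hC : IsFacetOrdering S.cones C) (h : ∀ j, ∃ γ ∈ (C j).latticePoints,
      newPoints C j = (fun a => γ + a) '' (C j).latticePoints) :
    IsCleanRing (ToricFaceRing K S) := by
  have hmax : ∀ i, Maximal (· ∈ S.cones) (C i) := fun i => (hC.2 _).1 ⟨i, rfl⟩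
  choose γ hγ hnew using h
  have hγnew : ∀ j, γ j ∈ newPoints C j := fun j => by
    rw [hnew]
    exact ⟨0, zero_mem_latticePoints _, add_zero _⟩
  let P : Fin s → PrimeSpectrum (ToricFaceRing K S) := fun i =>
    ⟨facePrime K (hmax i.rev).prop, inferInstance⟩
  let N : Fin (s + 1) → Ideal (ToricFaceRing K S) := fun i =>
    ⨅ k : Fin s, ⨅ _ : i ≤ k.castSucc, facePrime K (hmax k.rev).prop
  have hmemN : ∀ (i : Fin (s + 1)) (f : ToricFaceRing K S), f ∈ N i ↔
      ∀ k : Fin s, i ≤ k.castSucc → f ∈ facePrime K (hmax k.rev).prop := by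
    intro i f
    simp only [N, Submodule.mem_iInf]
  refine isCleanRing_iff.2 ⟨s, N, P, ?_, ?_, fun i => ⟨fun f hf => ?_, ?_⟩, ?_⟩
  · refine (Submodule.eq_bot_iff _).2 fun f hf => eq_zero_of_forall_mem_facePrime fun D hD => ?_
    obtain ⟨j, rfl⟩ := (hC.2 D).2 hD
    have := (hmemN 0 f).1 hf j.rev (Fin.zero_le _)
    simpa using this
  · refine (Submodule.eq_top_iff').2 fun f => (hmemN _ _).2 fun k hk => ?_
    exact absurd hk (not_le.2 (Fin.castSucc_lt_last k))
  · rw [hmemN] at hf ⊢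
    exact fun k hk => hf k (Fin.castSucc_lt_succ.le.trans hk)
  · let y : ToricFaceRing K S := monomial ⟨γ i.rev, C i.rev, (hmax _).prop, hγ _⟩
    have hyN : y ∈ N i.succ := (hmemN _ _).2 fun k hk => monomial_mem_facePrime.2
      ((hγnew i.rev).2 k.rev (Fin.rev_lt_rev.2 (Fin.succ_le_castSucc_iff.1 hk)))
    have hyP : y ∉ facePrime K (hmax i.rev).prop := fun h =>
      monomial_mem_facePrime.1 h (hγ i.rev)
    refine ⟨y, hyN, fun x hx => ?_, fun g => ⟨fun hg => ?_, fun hg => ?_⟩⟩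
    -- Generation is checked monomial by monomial: an exponent in the current facet is new, hence
    -- `γ` plus a lattice point of the facet; any other monomial of `x` already lies in `N
    -- i.castSucc`.
    · have hterm : ∀ a : S.latticePoints, ∃ g : ToricFaceRing K S,
          a ∈ support x → monomial a - g * y ∈ N i.castSucc := by
        intro a
        by_cases hax : a ∈ support x
        · have hlt : ∀ k, i < k → (a : Fin d → ℤ) ∉ (C k.rev).latticePoints := fun k hk hak =>
            mem_support.1 hax (mem_facePrime.1
              ((hmemN _ _).1 hx k (Fin.succ_le_castSucc_iff.2 hk)) a hak)
          by_cases haC : (a : Fin d → ℤ) ∈ (C i.rev).latticePoints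
          · have hanew : (a : Fin d → ℤ) ∈ newPoints C i.rev := by
              refine ⟨haC, fun k hk => ?_⟩
              have := hlt k.rev (Fin.lt_rev_iff.1 hk)
              simpa using this
            rw [hnew] at hanew
            obtain ⟨m, hm, hma⟩ := hanew
            have hmS : m ∈ S.latticePoints := ⟨C i.rev, (hmax _).prop, hm⟩
            refine ⟨monomial ⟨m, hmS⟩, fun _ => ?_⟩
            have hmul : (monomial ⟨m, hmS⟩ * y : ToricFaceRing K S) = monomial a := by
              rw [monomial_mul_monomial, dif_pos ⟨C i.rev, (hmax _).prop, hm, hγ _⟩]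
              congr 1
              refine Subtype.ext ?_
              rw [← hma]
              exact add_comm _ _
            rw [hmul, sub_self]
            exact Ideal.zero_mem _
          · refine ⟨0, fun _ => ?_⟩
            rw [zero_mul, sub_zero, hmemN]
            intro k hk
            rcases (Fin.castSucc_le_castSucc_iff.1 hk).eq_or_lt with rfl | hik
            · exact monomial_mem_facePrime.2 haC
            · exact monomial_mem_facePrime.2 (hlt k hik)
        · exact ⟨0, fun h => absurd h hax⟩
      choose g hg using hterm
      refine ⟨∑ a ∈ support x, coeff a x • g a, ?_⟩
      have hsum : x - (∑ a ∈ support x, coeff a x • g a) * y =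
          ∑ a ∈ support x, coeff a x • (monomial a - g a * y) := by
        simp only [smul_sub, Finset.sum_sub_distrib, Finset.sum_mul]
        refine congrArg₂ _ (eq_sum_monomial x) (Finset.sum_congr rfl fun a _ => ?_)
        have := smul_mul_smul' (coeff a x) 1 (g a) y
        rwa [one_smul, mul_one] at this
      rw [hsum]
      exact Ideal.sum_mem _ fun a ha => smul_mem_ideal _ _ (hg a ha)
    · exact (Ideal.IsPrime.mem_or_mem inferInstance ((hmemN _ _).1 hg i le_rfl)).resolve_right hyP
    · refine (hmemN _ _).2 fun k hk => ?_
      rcases (Fin.castSucc_le_castSucc_iff.1 hk).eq_or_lt with rfl | hik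
      · exact Ideal.mul_mem_right _ _ hg
      · exact Ideal.mul_mem_left _ _
          ((hmemN _ _).1 hyN k (Fin.succ_le_castSucc_iff.2 hik))
  · ext p
    refine ⟨?_, fun hp => ?_⟩
    · rintro ⟨i, rfl⟩
      exact (isMin_iff _).2 ⟨_, hmax i.rev, rfl⟩
    · obtain ⟨D, hD, hpD⟩ := (isMin_iff p).1 hp
      obtain ⟨j, rfl⟩ := (hC.2 D).2 hD
      refine ⟨j.rev, PrimeSpectrum.ext ?_⟩
      rw [hpD]
      simp only [P, Fin.rev_rev]

theorem isCleanRing_iff_exists_shelling : IsCleanRing (ToricFaceRing K S) ↔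
    ∃ (s : ℕ) (C : Fin s → RCone d), IsShelling S.cones C ∧
      ∀ j : Fin s, 0 < (j : ℕ) → ∃ γ ∈ (C j).latticePoints,
        latticeStar (C j).fan γ = ((C j).fan \ (⋃ i : Fin s, ⋃ _ : i < j, (C i).fan)) ∧
        (⋃ D ∈ latticeStar (C j).fan γ, D.relintLatticePoints) =
          (fun a => γ + a) '' (C j).latticePoints := by
  constructor
  · intro h
    obtain ⟨s, C, hC, hnew⟩ := exists_newPoints_eq_of_isCleanRing h
    have hCS : ∀ i, C i ∈ S.cones := fun i => ((hC.2 _).1 ⟨i, rfl⟩).prop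
    refine ⟨s, C, isShelling_of_newPoints_eq hC hnew, fun j _ => ?_⟩
    obtain ⟨γ, hγ, h⟩ := hnew j
    have hstar := latticeStar_eq_of_newPoints_eq hCS h
    exact ⟨γ, hγ, hstar, (iUnion_relintLatticePoints_eq_newPoints hCS hstar).trans h⟩
  · rintro ⟨s, C, hsh, h⟩
    have hC : IsFacetOrdering S.cones C := by
      cases hsh with
      | dim_zero facets _ => exact facets
      | step facets _ _ _ _ => exact facets
    have hCS : ∀ i, C i ∈ S.cones := fun i => ((hC.2 _).1 ⟨i, rfl⟩).prop
    refine isCleanRing_of_newPoints_eq hC fun j => ?_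
    rcases Nat.eq_zero_or_pos (j : ℕ) with h0 | h0
    -- All lattice points of the first facet are new, so `γ = 0` supplies the case left out of
    -- condition (ii).
    · refine ⟨0, zero_mem_latticePoints _, ?_⟩
      ext a
      simp only [zero_add, Set.image_id']
      exact ⟨fun ha => ha.1, fun ha => ⟨ha, fun i hi => absurd hi (by
        rw [Fin.lt_def, h0]; exact Nat.not_lt_zero _)⟩⟩
    · obtain ⟨γ, hγ, hstar, hrel⟩ := h j h0
      exact ⟨γ, hγ, (iUnion_relintLatticePoints_eq_newPoints hCS hstar).symm.trans hrel⟩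

end ToricFaceRing

theorem theorem5p9 {d : ℕ} (S : RationalPointedFan d)
    (K : Type*) [Field K] (L : Type*) [Field L] :
    (IsCleanRing (ToricFaceRing K S) ↔
      ∃ (s : ℕ) (C : Fin s → RCone d),
        IsShelling S.cones C ∧
        ∀ j : Fin s, 0 < (j : ℕ) →
          ∃ γ ∈ (C j).latticePoints,
            latticeStar (C j).fan γ = ((C j).fan \ (⋃ i : Fin s, ⋃ _ : i < j, (C i).fan)) ∧
            (⋃ D ∈ latticeStar (C j).fan γ, D.relintLatticePoints) =
              (fun a => γ + a) '' (C j).latticePoints) ∧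
    (IsCleanRing (ToricFaceRing K S) ↔ IsCleanRing (ToricFaceRing L S)) :=
  ⟨ToricFaceRing.isCleanRing_iff_exists_shelling,
    ToricFaceRing.isCleanRing_iff_exists_shelling.trans
      ToricFaceRing.isCleanRing_iff_exists_shelling.symm⟩
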